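/- Let $d\ge 0$ be an integer. All representations of $\mathrm{SU}(d)$ considered are continuous, unitary and finite-dimensional over $\mathbb{C}$. A vector $v$ has weight $w=(w_1,\dots,w_d)\in\mathbb{Z}^d$ if every diagonal matrix $h=\mathrm{diag}(h_1,\dots,h_d)\in\mathrm{SU}(d)$ acts on it by $hv=\prod_i h_i^{w_i}\,v$ (so $w$ matters only modulo $\mathbb{Z}(1,\dots,1)$). Weights are ordered by $w\preceq w'$ if $w'-w$ is, modulo multiples of $(1,\dots,1)$, a combination of the simple roots $\alpha_i=(0,\dots,0,1,-1,0,\dots,0)$ with nonnegative coefficients. The highest weight of an irreducible representation is the weight that is $\succeq$ all its weights. Let $\mathcal{R}_\mu$ and $\mathcal{R}_\nu$ be irreducible representations of $\mathrm{SU}(d)$ with highest weights $\mu$ and $\nu$, and let $\mathcal{R}_{\lambda}\subset\mathcal{R}_\mu\otimes\mathcal{R}_\nu$ be an irreducible subrepresentation with highest weight $\lambda=\mu+\nu$. Let $|\mu\rangle\in\mathcal{R}_\mu$ be a unit vector of weight $\mu$, and let $|\Psi\rangle\in\mathcal{R}_\lambda$ be a unit vector. Then there is a Borel probability measure $m$ on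 $\mathrm{SU}(d)$ such that $$\Bigl\|\mathrm{tr}_{\mathcal{R}_\nu}|\Psi\rangle\langle\Psi|-\int_{\mathrm{SU}(d)} g|\mu\rangle\langle\mu|g^\dagger\,dm(g)\Bigr\|\le 2\Bigl(1-\frac{\dim\mathcal{R}_\nu}{\dim\mathcal{R}_{\lambda}}\Bigr),$$ where $\mathrm{tr}_{\mathcal{R}_\nu}$ is the partial trace over the second tensor factor and $\|A\|=\tfrac12\,\mathrm{tr}\sqrt{A^\dagger A}$. -/

import Mathlib

open scoped TensorProduct

noncomputable section

/-- The group `SU(d)` of unitary `d × d` matrices of determinant one (with the topology it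
inherits from the space of matrices). -/
abbrev SU (d : ℕ) : Type := Matrix.specialUnitaryGroup (Fin d) ℂ

/-- `SU(d)` carries its Borel `σ`-algebra. -/
instance SU.instMeasurableSpace (d : ℕ) : MeasurableSpace (SU d) := borel (SU d)

instance SU.instBorelSpace (d : ℕ) : BorelSpace (SU d) := ⟨rfl⟩

/-- A continuous unitary representation of `SU(d)` on a complex inner product space. -/
structure IsUnitaryRep {d : ℕ} {V : Type*} [NormedAddCommGroup V] [InnerProductSpace ℂ V]
    (ρ : Representation ℂ (SU d) V) : Prop where
  inner_map_map : ∀ (g : SU d) (x y : V), inner ℂ (ρ g x) (ρ g y) = inner ℂ x y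
  continuous_apply : ∀ x : V, Continuous fun g : SU d => ρ g x

/-- `v` is a vector of weight `w = (w₁, …, w_d)` in the representation `ρ`: every diagonal matrix
`h` in `SU(d)` acts on `v` as the scalar `∏ h_i ^ w_i`. Integer vectors that differ by a multiple
of `(1, …, 1)` describe the same weight, as the entries of `h` have product one. -/
def IsWeightVector {d : ℕ} {V : Type*} [AddCommGroup V] [Module ℂ V]
    (ρ : Representation ℂ (SU d) V) (w : Fin d → ℤ) (v : V) : Prop :=
  ∀ h : SU d, (h : Matrix (Fin d) (Fin d) ℂ).IsDiag →
    ρ h v = (∏ i, (h : Matrix (Fin d) (Fin d) ℂ) i i ^ w i) • v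

/-- `w` is a weight of `ρ`: there is a non-zero vector of weight `w`. -/
def IsWeight {d : ℕ} {V : Type*} [AddCommGroup V] [Module ℂ V]
    (ρ : Representation ℂ (SU d) V) (w : Fin d → ℤ) : Prop :=
  ∃ v : V, v ≠ 0 ∧ IsWeightVector ρ w v

/-- The simple root `α_i = (0, …, 0, 1, -1, 0, …, 0)`, with the `1` at position `i`
(positions are counted from `0`; this is used for `i + 1 < d` only). -/
def simpleRoot (d i : ℕ) (j : Fin d) : ℝ :=
  if (j : ℕ) = i then 1 else if (j : ℕ) = i + 1 then -1 else 0

/-- The ordering of weights: `w ⪯ w'` if `w' - w` is a combination of the simple roots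
`α_0, …, α_{d-2}` with nonnegative coefficients, up to a multiple of `(1, …, 1)`
(which is zero as a weight of `SU(d)`). -/
def WeightLE {d : ℕ} (w w' : Fin d → ℤ) : Prop :=
  ∃ (n : ℕ → ℝ) (c : ℝ), (∀ i, 0 ≤ n i) ∧
    ∀ j, (w' j : ℝ) - (w j : ℝ) = (∑ i ∈ Finset.range (d - 1), n i * simpleRoot d i j) + c

/-- `μ` is the highest weight of `ρ`: it is a weight, and all weights `w` satisfy `w ⪯ μ`. -/
def IsHighestWeight {d : ℕ} {V : Type*} [AddCommGroup V] [Module ℂ V]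
    (ρ : Representation ℂ (SU d) V) (μ : Fin d → ℤ) : Prop :=
  IsWeight ρ μ ∧ ∀ w : Fin d → ℤ, IsWeight ρ w → WeightLE w μ

/-- The rank one operator `|ψ⟩⟨ψ|`. -/
def ketbra {E : Type*} [NormedAddCommGroup E] [InnerProductSpace ℂ E] (ψ : E) : E →L[ℂ] E :=
  InnerProductSpace.rankOne ℂ ψ ψ

/-- The partial trace over the second factor: the linear map `End (V ⊗ W) → End V` that sends
`A ⊗ B` to `tr(B) • A`. -/
def partialTrace {V W : Type*} [NormedAddCommGroup V] [InnerProductSpace ℂ V]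
    [FiniteDimensional ℂ V] [NormedAddCommGroup W] [InnerProductSpace ℂ W]
    [FiniteDimensional ℂ W] (A : V ⊗[ℂ] W →L[ℂ] V ⊗[ℂ] W) : V →L[ℂ] V :=
  LinearMap.toContinuousLinearMap
    (TensorProduct.rid ℂ (V →ₗ[ℂ] V)
      (LinearMap.lTensor (V →ₗ[ℂ] V) (LinearMap.trace ℂ W)
        ((homTensorHomEquiv ℂ V W V W).symm A.toLinearMap)))

/-- `½ tr √(A† A)`, the trace norm with the normalization for which the distance of two states is
their trace distance. -/
def traceNorm {V : Type*} [NormedAddCommGroup V] [InnerProductSpace ℂ V] [CompleteSpace V]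
    (A : V →L[ℂ] V) : ℝ :=
  (1 / 2) * (LinearMap.trace ℂ V (CFC.sqrt (star A * A)).toLinearMap).re

end

open MeasureTheory

/-! ### The topological group `SU(d)` and its exponential map -/

/-! Let `V`, `W` carry the two factors, let `C` be the irreducible subrepresentation, `v` and `w`
unit highest weight vectors, ξ the partial trace, r = dim W / dim C, and c(g) = ⟨gv ⊗ gw, Ψ⟩. The
measure is dim C · |c(g)|² dg, with dg the Haar measure; let B be the resulting mixture of the
|gv⟩⟨gv|.

Put u_g = (1 ⊗ ⟨gw|)Ψ. Schur orthogonality in `W` says that the Haar average of |u_g⟩⟨u_g| is ξ /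
dim W. The component of u_g along gv is c(g) gv, and its rank one operators average to B / dim C.
Schur orthogonality in `C` gives ξ / dim C for each of the two cross terms. Hence the average S₀ ≥ 0
of the rank one operators of the residuals u_g - c(g) gv satisfies dim W · S₀ = (1 - 2r) ξ + r B,
that is, ξ - B = 2(1 - r) ξ - (dim W · S₀ + (1 - r) B). Both operators on the right are positive
with trace 2(1 - r), so half the trace norm of their difference is at most 2(1 - r). This part is
carried by `IsUnitaryRep.integral_orbit`, `inner_integral_ketbra_residualVector` and
`traceNorm_sub_le`.

Orthogonality in `C` needs v ⊗ w ∈ C (`tmul_mem_of_isWeight`): the weight μ + ν has multiplicity one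
in V ⊗ W, because an irreducible representation is spanned by a highest weight vector and weight
vectors of strictly lower level (`IsHighestWeight.span_sup_lowerWeightSpan`). That is the usual
lowering argument in the Lie algebra sl(d). A continuous representation is differentiated by first
extending it to an entire function of the matrix (`IsUnitaryRep.exists_entire_extension`), which is
multiplicative on SL(d, ℂ); its derivative at 1 is the Lie algebra action. -/

instance SU.instIsTopologicalGroup (d : ℕ) : IsTopologicalGroup (SU d) where
  continuous_inv := by
    refine Continuous.subtype_mk ?_ _
    exact continuous_star.comp continuous_subtype_val

theorem SU.mul_star_self {d : ℕ} (g : SU d) : (g : Matrix (Fin d) (Fin d) ℂ) * star g.1 = 1 :=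
  Matrix.mem_unitaryGroup_iff.1 g.2.1

theorem SU.star_mul_self {d : ℕ} (g : SU d) : star g.1 * (g : Matrix (Fin d) (Fin d) ℂ) = 1 :=
  Matrix.mem_unitaryGroup_iff'.1 g.2.1

theorem SU.det_coe {d : ℕ} (g : SU d) : (g : Matrix (Fin d) (Fin d) ℂ).det = 1 := g.2.2

theorem SU.coe_inv {d : ℕ} (g : SU d) : ((g⁻¹ : SU d) : Matrix (Fin d) (Fin d) ℂ) = star g.1 := rfl

instance SU.instCompactSpace (d : ℕ) : CompactSpace (SU d) := by
  open scoped Matrix.Norms.Elementwise in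
  refine isCompact_iff_compactSpace.1 (Metric.isCompact_of_isClosed_isBounded ?_ ?_)
  · have h : ((Matrix.specialUnitaryGroup (Fin d) ℂ : Submonoid _) :
        Set (Matrix (Fin d) (Fin d) ℂ)) = {A | A * star A = 1} ∩ {A | A.det = 1} := by
      ext A
      simp [Matrix.mem_specialUnitaryGroup_iff, Matrix.mem_unitaryGroup_iff]
    rw [h]
    exact (isClosed_eq (by fun_prop) continuous_const).inter
      (isClosed_eq (by fun_prop) continuous_const)
  · refine isBounded_iff_forall_norm_le.2 ⟨1, fun A hA => ?_⟩
    exact (Matrix.norm_le_iff zero_le_one).2 fun i j => entry_norm_bound_of_unitary hA.1 i j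

/-- The normalized Haar measure of `SU(d)`. -/
noncomputable def SU.haar (d : ℕ) : Measure (SU d) := Measure.haarMeasure ⊤

instance SU.instIsHaarMeasure (d : ℕ) : (SU.haar d).IsHaarMeasure := by
  unfold SU.haar; infer_instance

instance SU.instIsProbabilityMeasure (d : ℕ) : IsProbabilityMeasure (SU.haar d) :=
  ⟨by simpa [SU.haar] using Measure.haarMeasure_self (G := SU d) (K₀ := ⊤)⟩

theorem SU.integrable_haar {d : ℕ} {E : Type*} [NormedAddCommGroup E] {f : SU d → E}
    (hf : Continuous f) : Integrable f (SU.haar d) :=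
  hf.integrable_of_hasCompactSupport (HasCompactSupport.of_compactSpace f)

/-- Conjugation by the eigenvector unitary reduces this to a diagonal matrix. It places the
exponentials of su(d) in `SU d`. -/
theorem Matrix.IsHermitian.det_exp_I_smul {n : Type*} [Fintype n] [DecidableEq n]
    {A : Matrix n n ℂ} (hA : A.IsHermitian) :
    (NormedSpace.exp (Complex.I • A)).det = Complex.exp (Complex.I * A.trace) := by
  have hU : IsUnit (hA.eigenvectorUnitary : Matrix n n ℂ) :=
    (Unitary.toUnits hA.eigenvectorUnitary).isUnit
  have hinv : (hA.eigenvectorUnitary : Matrix n n ℂ)⁻¹ =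
      star (hA.eigenvectorUnitary : Matrix n n ℂ) :=
    Matrix.inv_eq_right_inv (Unitary.mul_star_self_of_mem hA.eigenvectorUnitary.2)
  have key : Complex.I • A = (hA.eigenvectorUnitary : Matrix n n ℂ) *
      (Matrix.diagonal fun i => Complex.I * hA.eigenvalues i) *
        (hA.eigenvectorUnitary : Matrix n n ℂ)⁻¹ := by
    conv_lhs => rw [hA.spectral_theorem, Unitary.conjStarAlgAut_apply]
    rw [hinv, ← Matrix.smul_mul, ← Matrix.mul_smul, ← Matrix.diagonal_smul]
    rfl
  rw [key, Matrix.exp_conj _ _ hU, Matrix.det_conj hU, Matrix.exp_diagonal, Matrix.det_diagonal,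
    hA.trace_eq_sum_eigenvalues, Finset.mul_sum, Complex.exp_sum]
  refine Finset.prod_congr rfl fun i _ => ?_
  rw [Pi.coe_exp, Complex.exp_eq_exp_ℂ]
  rfl

theorem exp_mem_specialUnitaryGroup {d : ℕ} {X : Matrix (Fin d) (Fin d) ℂ} (hX : star X = -X)
    (htr : X.trace = 0) : NormedSpace.exp X ∈ Matrix.specialUnitaryGroup (Fin d) ℂ := by
  have hH : ((-Complex.I) • X).IsHermitian := by
    rw [Matrix.IsHermitian, Matrix.conjTranspose_smul, ← Matrix.star_eq_conjTranspose, hX]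
    simp
  have hXH : X = Complex.I • ((-Complex.I) • X) := by simp [smul_smul]
  refine ⟨Matrix.mem_unitaryGroup_iff.2 ?_, ?_⟩
  · rw [Matrix.star_eq_conjTranspose, ← Matrix.exp_conjTranspose, ← Matrix.star_eq_conjTranspose,
      hX, ← Matrix.exp_add_of_commute _ _ ((Commute.refl X).neg_right), add_neg_cancel,
      NormedSpace.exp_zero]
  · change Matrix.det _ = 1
    rw [hXH, hH.det_exp_I_smul, Matrix.trace_smul, htr]
    simp

/-- The element `exp X` of `SU(d)`, for a traceless skew-Hermitian matrix `X`. -/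
noncomputable def SU.exp {d : ℕ} (X : Matrix (Fin d) (Fin d) ℂ) (hX : star X = -X)
    (htr : X.trace = 0) : SU d :=
  ⟨NormedSpace.exp X, exp_mem_specialUnitaryGroup hX htr⟩

/-- A traceless complex matrix is `A + i B` with traceless skew-Hermitian `A` and `B`. -/
theorem exists_skewHermitian_add_I_smul {d : ℕ} {X : Matrix (Fin d) (Fin d) ℂ} (htr : X.trace = 0) :
    ∃ A B : Matrix (Fin d) (Fin d) ℂ, star A = -A ∧ star B = -B ∧ A.trace = 0 ∧ B.trace = 0 ∧
      X = A + Complex.I • B := by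
  have hs : (star X).trace = 0 := by
    rw [Matrix.star_eq_conjTranspose, Matrix.trace_conjTranspose, htr, star_zero]
  refine ⟨(1 / 2 : ℂ) • (X - star X), (-Complex.I / 2) • (X + star X), ?_, ?_, ?_, ?_, ?_⟩
  · rw [star_smul, star_sub, star_star, ← smul_neg, neg_sub]; simp
  · rw [star_smul, star_add, star_star, ← neg_smul, add_comm]; simp [neg_div]
  · simp [Matrix.trace_sub, htr, hs]
  · simp [Matrix.trace_add, htr, hs]
  · rw [smul_smul]
    have : Complex.I * (-Complex.I / 2) = 1 / 2 := by
      rw [mul_div_assoc', mul_neg, Complex.I_mul_I, neg_neg]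
    rw [this, ← smul_add]
    have : X - star X + (X + star X) = (2 : ℂ) • X := by rw [two_smul]; abel
    rw [this, smul_smul]; norm_num

open scoped Matrix.Norms.Operator in
/-- An entire function on matrices that vanishes on `su(d)` vanishes on `sl(d)`. -/
theorem eq_zero_of_eq_zero_on_skew {d : ℕ} {E : Type*} [NormedAddCommGroup E] [NormedSpace ℂ E]
    [CompleteSpace E] {H : Matrix (Fin d) (Fin d) ℂ → E} (hH : Differentiable ℂ H)
    (h0 : ∀ X, star X = -X → X.trace = 0 → H X = 0) {X : Matrix (Fin d) (Fin d) ℂ}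
    (htr : X.trace = 0) : H X = 0 := by
  obtain ⟨A, B, hA, hB, tA, tB, rfl⟩ := exists_skewHermitian_add_I_smul htr
  have hd : Differentiable ℂ fun z : ℂ => H (A + z • B) :=
    hH.comp ((differentiable_const A).add (differentiable_id.smul_const B))
  have han : AnalyticOnNhd ℂ (fun z : ℂ => H (A + z • B)) Set.univ := fun z _ => hd.analyticAt z
  -- For real t the matrix A + tB lies in su(d). These zeros accumulate at 0, so the one-variable
  -- identity theorem gives vanishing for all z, in particular at z = i.
  have h0' : ∀ t : ℝ, H (A + (t : ℂ) • B) = 0 := fun t => by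
    refine h0 _ ?_ ?_
    · rw [star_add, star_smul, hA, hB]
      simp; abel
    · simp [Matrix.trace_add, Matrix.trace_smul, tA, tB]
  have hfr : ∃ᶠ z : ℂ in nhdsWithin 0 {0}ᶜ, H (A + z • B) = (fun _ => 0 : ℂ → E) z := by
    have ht : Filter.Tendsto (fun t : ℝ => (t : ℂ)) (nhdsWithin 0 {0}ᶜ) (nhdsWithin 0 {0}ᶜ) := by
      refine tendsto_nhdsWithin_of_tendsto_nhds_of_eventually_within _ ?_ ?_
      · exact (Complex.continuous_ofReal.tendsto' 0 0 (by simp)).mono_left nhdsWithin_le_nhds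
      · filter_upwards [self_mem_nhdsWithin] with t ht
        simpa using ht
    exact ht.frequently (Filter.Frequently.of_forall h0')
  exact congrFun (han.eq_of_frequently_eq (fun z _ => analyticAt_const) hfr) Complex.I

section EntireExtension

open scoped Matrix.Norms.Operator

/-! ### Entire extension of the matrix coefficients -/

namespace IsUnitaryRep

variable {d : ℕ} {V : Type*} [NormedAddCommGroup V] [InnerProductSpace ℂ V]
  {ρ : Representation ℂ (SU d) V}

theorem norm_map (hρ : IsUnitaryRep ρ) (g : SU d) (x : V) : ‖ρ g x‖ = ‖x‖ := by
  rw [@norm_eq_sqrt_re_inner ℂ, @norm_eq_sqrt_re_inner ℂ, hρ.inner_map_map]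

end IsUnitaryRep

theorem Representation.IsIrreducible.nontrivial {d : ℕ} {V : Type*} [AddCommGroup V] [Module ℂ V]
    {ρ : Representation ℂ (SU d) V} (hirr : ρ.IsIrreducible) : Nontrivial V := by
  by_contra h
  rw [not_nontrivial_iff_subsingleton] at h
  have : (⊥ : Subrepresentation ρ) = ⊤ :=
    Subrepresentation.toSubmodule_injective (Subsingleton.elim _ _)
  exact hirr.toNontrivial.exists_pair_ne.elim fun a ⟨b, hab⟩ =>
    bot_ne_top (α := Subrepresentation ρ) this

/-- An invariant subspace that contains a non-zero vector is everything. -/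
theorem Representation.IsIrreducible.eq_top {d : ℕ} {V : Type*} [AddCommGroup V] [Module ℂ V]
    {ρ : Representation ℂ (SU d) V} (hirr : ρ.IsIrreducible) (U : Submodule ℂ V)
    (hU : ∀ g, ∀ u ∈ U, ρ g u ∈ U) {v : V} (hv : v ∈ U) (hv0 : v ≠ 0) : U = ⊤ := by
  rcases hirr.eq_bot_or_eq_top ⟨U, fun g u hu => hU g u hu⟩ with h | h
  · have : U = ⊥ := congrArg Subrepresentation.toSubmodule h
    rw [this, Submodule.mem_bot] at hv
    exact absurd hv hv0
  · exact congrArg Subrepresentation.toSubmodule h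

/-- The function `(g, h) ↦ f (g⁻¹ h)` is a finite sum of products of an entire function of the
matrix `g` and a continuous function of `h`. -/
def HasEntireTranslates {d : ℕ} (f : C(SU d, ℂ)) : Prop :=
  ∃ (ι : Type) (_ : Fintype ι) (a : ι → Matrix (Fin d) (Fin d) ℂ → ℂ) (b : ι → C(SU d, ℂ)),
    (∀ i, Differentiable ℂ (a i)) ∧ ∀ g h : SU d, f (g⁻¹ * h) = ∑ i, a i g.1 * b i h

namespace HasEntireTranslates

variable {d : ℕ} {f f' : C(SU d, ℂ)}

theorem algebraMap (r : ℂ) : HasEntireTranslates (algebraMap ℂ C(SU d, ℂ) r) :=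
  ⟨Unit, inferInstance, fun _ _ => r, fun _ => 1, fun _ => differentiable_const r,
    fun g h => by simp⟩

theorem add (hf : HasEntireTranslates f) (hf' : HasEntireTranslates f') :
    HasEntireTranslates (f + f') := by
  obtain ⟨ι, _, a, b, ha, hab⟩ := hf
  obtain ⟨ι', _, a', b', ha', hab'⟩ := hf'
  refine ⟨ι ⊕ ι', inferInstance, Sum.elim a a', Sum.elim b b', ?_, fun g h => ?_⟩
  · rintro (i | i)
    exacts [ha i, ha' i]
  · simp [hab, hab']

theorem mul (hf : HasEntireTranslates f) (hf' : HasEntireTranslates f') :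
    HasEntireTranslates (f * f') := by
  obtain ⟨ι, _, a, b, ha, hab⟩ := hf
  obtain ⟨ι', _, a', b', ha', hab'⟩ := hf'
  refine ⟨ι × ι', inferInstance, fun i M => a i.1 M * a' i.2 M, fun i => b i.1 * b' i.2,
    fun i => (ha i.1).fun_mul (ha' i.2), fun g h => ?_⟩
  simp only [ContinuousMap.mul_apply, hab, hab', Finset.sum_mul_sum, Fintype.sum_prod_type]
  exact Finset.sum_congr rfl fun i _ => Finset.sum_congr rfl fun j _ => by ring

end HasEntireTranslates

/-- The coordinate function `g ↦ g i j`. -/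
def SU.entry {d : ℕ} (i j : Fin d) : C(SU d, ℂ) :=
  ⟨fun g => g.1 i j, (continuous_subtype_val).matrix_elem i j⟩

theorem differentiable_matrix_entry {d : ℕ} (i j : Fin d) :
    Differentiable ℂ fun M : Matrix (Fin d) (Fin d) ℂ => M i j :=
  (LinearMap.toContinuousLinearMap (Matrix.entryLinearMap ℂ ℂ i j)).differentiable

theorem differentiable_det {d n : ℕ} {A : Matrix (Fin d) (Fin d) ℂ → Matrix (Fin n) (Fin n) ℂ}
    (hA : ∀ i j, Differentiable ℂ fun M => A M i j) : Differentiable ℂ fun M => (A M).det := by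
  simp only [Matrix.det_apply]
  refine Differentiable.fun_sum fun σ _ => ?_
  refine Differentiable.const_smul ?_ _
  exact fun M => (HasFDerivAt.finsetProd fun i _ =>
    (hA (σ i) i M).hasFDerivAt).differentiableAt

theorem differentiable_adjugate_entry {d : ℕ} (i j : Fin d) :
    Differentiable ℂ fun M : Matrix (Fin d) (Fin d) ℂ => M.adjugate i j := by
  simp only [Matrix.adjugate_apply]
  refine differentiable_det fun k l => ?_
  by_cases h : k = j
  · simp only [Matrix.updateRow_apply, h, if_true]
    exact differentiable_const _
  · simp only [Matrix.updateRow_apply, h, if_false]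
    exact differentiable_matrix_entry k l

theorem SU.coe_inv_eq_adjugate {d : ℕ} (g : SU d) :
    ((g⁻¹ : SU d) : Matrix (Fin d) (Fin d) ℂ) = (g : Matrix (Fin d) (Fin d) ℂ).adjugate := by
  have h := Matrix.mul_adjugate (g : Matrix (Fin d) (Fin d) ℂ)
  rw [SU.det_coe, one_smul] at h
  rw [SU.coe_inv]
  calc star g.1 = star g.1 * (g.1 * g.1.adjugate) := by rw [h, mul_one]
    _ = g.1.adjugate := by rw [← mul_assoc, SU.star_mul_self, one_mul]

/-- On matrices of determinant one the inverse is the adjugate, which is polynomial in the entries.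
-/
theorem HasEntireTranslates.entry {d : ℕ} (i j : Fin d) : HasEntireTranslates (SU.entry i j) := by
  refine ⟨Fin d, inferInstance, fun k M => M.adjugate i k, fun k => SU.entry k j,
    fun k => differentiable_adjugate_entry i k, fun g h => ?_⟩
  change ((g⁻¹ : SU d).1 * h.1) i j = _
  rw [SU.coe_inv_eq_adjugate, Matrix.mul_apply]
  rfl

/-- As g⁻¹ = g*, the conjugates of the entries of g⁻¹ are entries of g, so no conjugation of g
remains. -/
theorem HasEntireTranslates.star_entry {d : ℕ} (i j : Fin d) :
    HasEntireTranslates (star (SU.entry i j)) := by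
  refine ⟨Fin d, inferInstance, fun k M => M k i, fun k => star (SU.entry k j),
    fun k => differentiable_matrix_entry k i, fun g h => ?_⟩
  change star (((g⁻¹ : SU d).1 * h.1) i j) = _
  rw [SU.coe_inv, Matrix.mul_apply, star_sum]
  refine Finset.sum_congr rfl fun k _ => ?_
  rw [StarMul.star_mul, Matrix.star_apply, star_star, mul_comm]
  rfl

/-- The star algebra generated by the matrix entries. -/
noncomputable def SU.entryAlgebra (d : ℕ) : StarSubalgebra ℂ C(SU d, ℂ) :=
  StarAlgebra.adjoin ℂ (Set.range fun p : Fin d × Fin d => SU.entry p.1 p.2)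

theorem HasEntireTranslates.of_mem_entryAlgebra {d : ℕ} {f : C(SU d, ℂ)}
    (hf : f ∈ SU.entryAlgebra d) : HasEntireTranslates f := by
  suffices HasEntireTranslates f ∧ HasEntireTranslates (star f) from this.1
  induction hf using StarAlgebra.adjoin_induction with
  | mem x hx =>
    obtain ⟨p, rfl⟩ := hx
    exact ⟨.entry _ _, .star_entry _ _⟩
  | algebraMap r =>
    refine ⟨.algebraMap r, ?_⟩
    rw [← algebraMap_star_comm]
    exact .algebraMap _
  | add x y _ _ hx hy => exact ⟨hx.1.add hy.1, by rw [star_add]; exact hx.2.add hy.2⟩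
  | mul x y _ _ hx hy => exact ⟨hx.1.mul hy.1, by rw [star_mul]; exact hy.2.mul hx.2⟩
  | star x _ hx => exact ⟨hx.2, by rw [star_star]; exact hx.1⟩

theorem SU.entryAlgebra_topologicalClosure (d : ℕ) :
    (SU.entryAlgebra d).topologicalClosure = ⊤ := by
  refine ContinuousMap.starSubalgebra_topologicalClosure_eq_top_of_separatesPoints _ ?_
  intro g h hgh
  have : ∃ i j, g.1 i j ≠ h.1 i j := by
    by_contra! hc
    exact hgh (Subtype.ext (Matrix.ext hc))
  obtain ⟨i, j, hij⟩ := this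
  exact ⟨_, ⟨SU.entry i j, StarAlgebra.subset_adjoin ℂ _ ⟨(i, j), rfl⟩, rfl⟩, hij⟩

theorem differentiable_rankOne_left {V : Type*} [NormedAddCommGroup V] [InnerProductSpace ℂ V]
    (e : V) : Differentiable ℂ fun x : V => InnerProductSpace.rankOne ℂ x e :=
  ((ContinuousLinearMap.smulRightL ℂ V V (innerSL ℂ e))).differentiable

/-! ### Smeared vectors and the entire extension of a representation -/

section Extension

variable {d : ℕ} {V : Type*} [NormedAddCommGroup V] [InnerProductSpace ℂ V]
  {ρ : Representation ℂ (SU d) V}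

/-- The vector `∫ f(h) ρ(h) v dh`, as a continuous linear function of `f`. -/
noncomputable def IsUnitaryRep.smear (hρ : IsUnitaryRep ρ) (v : V) : C(SU d, ℂ) →L[ℂ] V :=
  LinearMap.mkContinuous
    { toFun := fun f => ∫ h, f h • ρ h v ∂SU.haar d
      map_add' := fun f f' => by
        simp only [ContinuousMap.add_apply, add_smul]
        exact integral_add
          (SU.integrable_haar (f.continuous.smul (hρ.continuous_apply v)))
          (SU.integrable_haar (f'.continuous.smul (hρ.continuous_apply v)))
      map_smul' := fun r f => by
        simp only [ContinuousMap.smul_apply, smul_assoc, RingHom.id_apply]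
        exact integral_smul r _ } ‖v‖ fun f => by
    refine (norm_integral_le_of_norm_le_const (C := ‖f‖ * ‖v‖) ?_).trans (by simp [mul_comm])
    refine Filter.Eventually.of_forall fun h => ?_
    rw [norm_smul, hρ.norm_map]
    exact mul_le_mul_of_nonneg_right (f.norm_coe_le_norm h) (norm_nonneg v)

theorem IsUnitaryRep.smear_apply (hρ : IsUnitaryRep ρ) (v : V) (f : C(SU d, ℂ)) :
    hρ.smear v f = ∫ h, f h • ρ h v ∂SU.haar d := rfl

theorem IsUnitaryRep.map_integral [FiniteDimensional ℂ V] (g : SU d) {f : SU d → V} (hf : Continuous f) :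
    ρ g (∫ h, f h ∂SU.haar d) = ∫ h, ρ g (f h) ∂SU.haar d :=
  ((LinearMap.toContinuousLinearMap (ρ g)).integral_comp_comm (SU.integrable_haar hf)).symm

theorem IsUnitaryRep.map_smear [FiniteDimensional ℂ V] (hρ : IsUnitaryRep ρ) (v : V) (f : C(SU d, ℂ)) (g : SU d) :
    ρ g (hρ.smear v f) = ∫ h, f (g⁻¹ * h) • ρ h v ∂SU.haar d := by
  rw [smear_apply, map_integral (f := fun h => f h • ρ h v) g
      (f.continuous.smul (hρ.continuous_apply v)),
    ← integral_mul_left_eq_self (fun h => f (g⁻¹ * h) • ρ h v) g]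
  simp

/-- By Stone–Weierstrass the entry algebra is dense, so otherwise every continuous f would smear `v`
to zero. The choice f(h) = ⟨ρ(h)v, v⟩, paired with `v`, gives the integral of |⟨v, ρ(h)v⟩|², which
is positive. -/
theorem IsUnitaryRep.exists_smear_ne_zero [FiniteDimensional ℂ V] (hρ : IsUnitaryRep ρ) {v : V} (hv : v ≠ 0) :
    ∃ f ∈ SU.entryAlgebra d, hρ.smear v f ≠ 0 := by
  by_contra! h0
  have hall : ∀ f, hρ.smear v f = 0 := by
    intro f
    have hf : f ∈ (SU.entryAlgebra d).topologicalClosure := by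
      rw [SU.entryAlgebra_topologicalClosure]; trivial
    have hcl : IsClosed {f | hρ.smear v f = 0} :=
      isClosed_eq (hρ.smear v).continuous continuous_const
    exact closure_minimal (s := (SU.entryAlgebra d : Set C(SU d, ℂ))) (fun f hf => h0 f hf) hcl hf
  have hc : Continuous fun h => inner ℂ (ρ h v) v := (hρ.continuous_apply v).inner continuous_const
  have h1 := congrArg (inner ℂ v) (hall ⟨_, hc⟩)
  rw [hρ.smear_apply, ContinuousMap.coe_mk, inner_zero_right, ← integral_inner
    (f := fun h => inner ℂ (ρ h v) v • ρ h v) (SU.integrable_haar (hc.smul (hρ.continuous_apply v)))] at h1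
  have h2 : ∀ h : SU d, inner ℂ v (inner ℂ (ρ h v) v • ρ h v) =
      ((‖inner ℂ v (ρ h v)‖ ^ 2 : ℝ) : ℂ) := by
    intro h
    rw [inner_smul_right, ← inner_conj_symm, RCLike.conj_mul]
    norm_cast
  rw [integral_congr_ae (.of_forall h2),
    integral_complex_ofReal] at h1
  have h3 : 0 < ∫ h, ‖inner ℂ v (ρ h v)‖ ^ 2 ∂SU.haar d := by
    refine Continuous.integral_pos_of_hasCompactSupport_nonneg_nonzero
      ((continuous_const.inner (hρ.continuous_apply v)).norm.pow 2)
      (HasCompactSupport.of_compactSpace _) (fun h => by positivity) (x := 1) ?_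
    simpa using hv
  exact h3.ne' (by exact_mod_cast h1)

/-- The vectors whose orbit map extends to an entire function on the space of matrices. -/
def entireVectors (ρ : Representation ℂ (SU d) V) : Submodule ℂ V where
  carrier := {v | ∃ F : Matrix (Fin d) (Fin d) ℂ → V, Differentiable ℂ F ∧ ∀ g : SU d, F g = ρ g v}
  add_mem' := by
    rintro v w ⟨F, hF, hFv⟩ ⟨F', hF', hFw⟩
    exact ⟨F + F', hF.add hF', fun g => by simp [hFv, hFw]⟩
  zero_mem' := ⟨0, differentiable_const 0, fun g => by simp⟩
  smul_mem' := by
    rintro c v ⟨F, hF, hFv⟩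
    exact ⟨c • F, hF.const_smul c, fun g => by simp [hFv]⟩

theorem map_mem_entireVectors (g : SU d) {v : V} (hv : v ∈ entireVectors ρ) :
    ρ g v ∈ entireVectors ρ := by
  obtain ⟨F, hF, hFv⟩ := hv
  refine ⟨fun M => F (M * g.1), Differentiable.comp (E := Matrix (Fin d) (Fin d) ℂ)
    (F := Matrix (Fin d) (Fin d) ℂ) hF
    (Differentiable.mul_const (E := Matrix (Fin d) (Fin d) ℂ) differentiable_id g.1),
    fun h => ?_⟩
  rw [← Module.End.mul_apply, ← map_mul, ← hFv]
  rfl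

theorem IsUnitaryRep.smear_mem_entireVectors [FiniteDimensional ℂ V] (hρ : IsUnitaryRep ρ) (v : V) {f : C(SU d, ℂ)}
    (hf : HasEntireTranslates f) : hρ.smear v f ∈ entireVectors ρ := by
  obtain ⟨ι, _, a, b, ha, hab⟩ := hf
  refine ⟨fun M => ∑ i, a i M • hρ.smear v (b i),
    Differentiable.fun_sum fun i _ => (ha i).smul_const _, fun g => ?_⟩
  simp only [hρ.map_smear, hab, Finset.sum_smul, mul_smul]
  rw [integral_finsetSum (f := fun i h => a i g.1 • b i h • ρ h v) _ fun i _ =>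
    SU.integrable_haar (((b i).continuous.smul (hρ.continuous_apply v)).const_smul _)]
  exact Finset.sum_congr rfl fun i _ => by rw [integral_smul]; rfl

theorem entireVectors_eq_top [FiniteDimensional ℂ V] (hρ : IsUnitaryRep ρ) (hirr : ρ.IsIrreducible) :
    entireVectors ρ = ⊤ := by
  have := hirr.nontrivial
  obtain ⟨v, hv⟩ := exists_ne (0 : V)
  obtain ⟨f, hf, hf0⟩ := hρ.exists_smear_ne_zero hv
  exact hirr.eq_top _ (fun g u hu => map_mem_entireVectors g hu)
    (hρ.smear_mem_entireVectors v (.of_mem_entryAlgebra hf)) hf0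

/-- An irreducible unitary representation of `SU(d)` is the restriction of an entire function. -/
theorem IsUnitaryRep.exists_entire_extension [FiniteDimensional ℂ V] (hρ : IsUnitaryRep ρ) (hirr : ρ.IsIrreducible) :
    ∃ Φ : Matrix (Fin d) (Fin d) ℂ → V →L[ℂ] V, Differentiable ℂ Φ ∧
      ∀ (g : SU d) (v : V), Φ g.1 v = ρ g v := by
  let e := stdOrthonormalBasis ℂ V
  have h : ∀ i, e i ∈ entireVectors ρ := fun i => by rw [entireVectors_eq_top hρ hirr]; trivial
  choose F hF hFe using h
  refine ⟨fun M => ∑ i, InnerProductSpace.rankOne ℂ (F i M) (e i), ?_, fun g v => ?_⟩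
  · refine Differentiable.fun_sum (E := Matrix (Fin d) (Fin d) ℂ) fun i _ => ?_
    exact Differentiable.comp (E := Matrix (Fin d) (Fin d) ℂ) (F := V)
      (g := fun x : V => InnerProductSpace.rankOne ℂ x (e i))
      (differentiable_rankOne_left (e i)) (hF i)
  · simp only [sum_apply, InnerProductSpace.rankOne_apply, hFe]
    conv_rhs => rw [← e.sum_repr' v, map_sum]
    simp

end Extension

/-! ### The complexified group and the infinitesimal action of `sl(d)` -/

theorem differentiable_matrix_exp {d : ℕ} :
    Differentiable ℂ (NormedSpace.exp : Matrix (Fin d) (Fin d) ℂ → Matrix (Fin d) (Fin d) ℂ) :=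
  fun X => (NormedSpace.exp_analytic (𝕂 := ℂ) X).differentiableAt

theorem det_exp_of_trace_eq_zero {d : ℕ} {X : Matrix (Fin d) (Fin d) ℂ} (htr : X.trace = 0) :
    (NormedSpace.exp X).det = 1 := by
  refine sub_eq_zero.1 (eq_zero_of_eq_zero_on_skew
    (H := fun X : Matrix (Fin d) (Fin d) ℂ => (NormedSpace.exp X).det - 1) ?_ ?_ htr)
  · exact Differentiable.sub_const (differentiable_det fun i j =>
      (differentiable_matrix_entry i j).comp differentiable_matrix_exp) _
  · intro X hX h
    exact sub_eq_zero.2 (SU.det_coe (SU.exp X hX h))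

theorem NormedSpace.exp_of_mul_self_eq_zero {A : Type*} [NormedRing A] [NormedAlgebra ℂ A]
    [CompleteSpace A] {X : A} (hX : X * X = 0) : NormedSpace.exp X = 1 + X := by
  rw [NormedSpace.exp_eq_tsum ℂ]
  simp only
  rw [tsum_eq_sum (s := Finset.range 2) fun n hn => ?_]
  · simp [Finset.sum_range_succ]
  · obtain ⟨k, rfl⟩ := Nat.exists_eq_add_of_le (not_lt.1 (Finset.mem_range.not.1 hn))
    rw [pow_add, pow_two, hX, zero_mul, smul_zero]

/-- The monoid generated by the exponentials of the traceless matrices. -/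
def expMonoid (d : ℕ) : Submonoid (Matrix (Fin d) (Fin d) ℂ) :=
  Submonoid.closure {A | ∃ X : Matrix (Fin d) (Fin d) ℂ, X.trace = 0 ∧ NormedSpace.exp X = A}

theorem exp_mem_expMonoid {d : ℕ} {X : Matrix (Fin d) (Fin d) ℂ} (htr : X.trace = 0) :
    NormedSpace.exp X ∈ expMonoid d :=
  Submonoid.subset_closure ⟨X, htr, rfl⟩

theorem diagonal_mem_expMonoid {d : ℕ} {D : Fin d → ℂ} (hD : (Matrix.diagonal D).det = 1) :
    Matrix.diagonal D ∈ expMonoid d := by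
  rw [Matrix.det_diagonal] at hD
  rcases isEmpty_or_nonempty (Fin d) with h | ⟨⟨i₀⟩⟩
  · rw [Subsingleton.elim (Matrix.diagonal D) 1]
    exact one_mem _
  have hD0 : ∀ i, D i ≠ 0 := fun i h => by
    rw [Finset.prod_eq_zero (Finset.mem_univ i) h] at hD
    exact zero_ne_one hD
  let x : Fin d → ℂ := fun i => Complex.log (D i)
  have hs : Complex.exp (∑ i, x i) = 1 := by
    rw [Complex.exp_sum, ← hD]
    exact Finset.prod_congr rfl fun i _ => Complex.exp_log (hD0 i)
  -- The logarithms sum only to a multiple of 2πi. Subtracting the sum from one coordinate makes the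
  -- trace zero and leaves the exponentials unchanged.
  let y : Fin d → ℂ := x - Pi.single i₀ (∑ i, x i)
  have hy : NormedSpace.exp (Matrix.diagonal y) = Matrix.diagonal D := by
    rw [Matrix.exp_diagonal]
    congr 1
    funext i
    have h1 : NormedSpace.exp y i = Complex.exp (y i) := by
      rw [Pi.coe_exp, Complex.exp_eq_exp_ℂ]
    rw [h1]
    by_cases hi : i = i₀
    · subst hi
      simp only [y, Pi.sub_apply, Pi.single_eq_same, Complex.exp_sub, hs, div_one]
      exact Complex.exp_log (hD0 i)
    · simp only [y, Pi.sub_apply, Pi.single_eq_of_ne hi, sub_zero]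
      exact Complex.exp_log (hD0 i)
  rw [← hy]
  refine exp_mem_expMonoid ?_
  simp [y, Matrix.trace_diagonal, Finset.sum_sub_distrib]

/-- Gaussian elimination writes the matrix as a product of transvections and a diagonal matrix; a
transvection is the exponential of a traceless matrix of square zero. -/
theorem mem_expMonoid_of_det_eq_one {d : ℕ} {M : Matrix (Fin d) (Fin d) ℂ} (hM : M.det = 1) :
    M ∈ expMonoid d := by
  refine Matrix.diagonal_transvection_induction (fun M => M ∈ expMonoid d) M ?_ ?_ ?_
  · exact fun D hD => diagonal_mem_expMonoid (hD.trans hM)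
  · intro t
    have h0 : Matrix.single t.i t.j t.c * Matrix.single t.i t.j t.c = 0 :=
      Matrix.single_mul_single_of_ne _ _ _ _ t.hij.symm _
    rw [Matrix.TransvectionStruct.toMatrix, Matrix.transvection,
      ← NormedSpace.exp_of_mul_self_eq_zero h0]
    exact exp_mem_expMonoid (Matrix.trace_single_eq_of_ne _ _ _ t.hij)
  · exact fun A B => mul_mem

/-- `Φ` is an entire function on the space of matrices that extends `ρ`. -/
structure IsEntireExtension {d : ℕ} {V : Type*} [NormedAddCommGroup V] [InnerProductSpace ℂ V]
    (ρ : Representation ℂ (SU d) V) (Φ : Matrix (Fin d) (Fin d) ℂ → V →L[ℂ] V) : Prop where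
  differentiable : Differentiable ℂ Φ
  apply_coe : ∀ (g : SU d) (v : V), Φ g.1 v = ρ g v

namespace IsEntireExtension

variable {d : ℕ} {V : Type*} [NormedAddCommGroup V] [InnerProductSpace ℂ V]
  {ρ : Representation ℂ (SU d) V} {Φ : Matrix (Fin d) (Fin d) ℂ → V →L[ℂ] V}

theorem map_one (hΦ : IsEntireExtension ρ Φ) : Φ 1 = 1 := by
  ext v
  simpa using hΦ.apply_coe 1 v

theorem map_mul_coe (hΦ : IsEntireExtension ρ Φ) (g h : SU d) :
    Φ (g.1 * h.1) = Φ g.1 * Φ h.1 := by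
  ext v
  have := hΦ.apply_coe (g * h) v
  rw [_root_.map_mul] at this
  simpa [hΦ.apply_coe] using this

variable [FiniteDimensional ℂ V]

/-- Induction on the word `N`: in its first letter exp X both sides are entire in X, so X may be
taken in su(d). Then exp X lies in `SU d` and is absorbed into `g`, which is why `g` varies in the
induction. -/
theorem map_coe_mul (hΦ : IsEntireExtension ρ Φ) {N : Matrix (Fin d) (Fin d) ℂ}
    (hN : N ∈ expMonoid d) (g : SU d) : Φ (g.1 * N) = Φ g.1 * Φ N := by
  have := FiniteDimensional.complete ℂ V
  induction hN using Submonoid.closure_induction_left generalizing g with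
  | one => rw [mul_one, hΦ.map_one, mul_one]
  | mul_left A hA N hN ih =>
    obtain ⟨X, htr, rfl⟩ := hA
    refine sub_eq_zero.1 (eq_zero_of_eq_zero_on_skew
      (H := fun X => Φ (g.1 * (NormedSpace.exp X * N)) - Φ g.1 * Φ (NormedSpace.exp X * N))
      ?_ ?_ htr)
    · refine Differentiable.fun_sub ?_ (Differentiable.const_mul ?_ _)
      · exact hΦ.differentiable.comp ((differentiable_matrix_exp.mul_const N).const_mul g.1)
      · exact hΦ.differentiable.comp (differentiable_matrix_exp.mul_const N)
    · intro X hX htr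
      have h1 := ih (g * SU.exp X hX htr)
      have h2 := ih (SU.exp X hX htr)
      have h3 := hΦ.map_mul_coe g (SU.exp X hX htr)
      change Φ (g.1 * NormedSpace.exp X * N) = Φ (g.1 * NormedSpace.exp X) * Φ N at h1
      change Φ (NormedSpace.exp X * N) = Φ (NormedSpace.exp X) * Φ N at h2
      change Φ (g.1 * NormedSpace.exp X) = Φ g.1 * Φ (NormedSpace.exp X) at h3
      rw [← mul_assoc, h1, h2, h3, mul_assoc, sub_self]

theorem map_exp_mul (hΦ : IsEntireExtension ρ Φ) {X N : Matrix (Fin d) (Fin d) ℂ}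
    (htr : X.trace = 0) (hN : N ∈ expMonoid d) :
    Φ (NormedSpace.exp X * N) = Φ (NormedSpace.exp X) * Φ N := by
  have := FiniteDimensional.complete ℂ V
  refine sub_eq_zero.1 (eq_zero_of_eq_zero_on_skew
    (H := fun X => Φ (NormedSpace.exp X * N) - Φ (NormedSpace.exp X) * Φ N) ?_ ?_ htr)
  · refine Differentiable.fun_sub ?_ (Differentiable.mul_const ?_ _)
    · exact hΦ.differentiable.comp (differentiable_matrix_exp.mul_const N)
    · exact hΦ.differentiable.comp differentiable_matrix_exp
  · intro X hX htr
    exact sub_eq_zero.2 (hΦ.map_coe_mul hN (SU.exp X hX htr))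

/-- The entire extension is multiplicative on `SL(d, ℂ)`. -/
theorem map_mul (hΦ : IsEntireExtension ρ Φ) {M N : Matrix (Fin d) (Fin d) ℂ}
    (hM : M.det = 1) (hN : N.det = 1) : Φ (M * N) = Φ M * Φ N := by
  replace hM := mem_expMonoid_of_det_eq_one hM
  replace hN := mem_expMonoid_of_det_eq_one hN
  induction hM using Submonoid.closure_induction_left with
  | one => rw [one_mul, hΦ.map_one, one_mul]
  | mul_left A hA M hM ih =>
    obtain ⟨X, htr, rfl⟩ := hA
    rw [mul_assoc, hΦ.map_exp_mul htr (mul_mem hM hN), ih, hΦ.map_exp_mul htr hM, mul_assoc]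

end IsEntireExtension

/-- The derivative at `1` of a function on matrices; for an entire extension of a representation
it is the induced representation of the Lie algebra. -/
noncomputable def lieMap {d : ℕ} {V : Type*} [NormedAddCommGroup V] [InnerProductSpace ℂ V]
    (Φ : Matrix (Fin d) (Fin d) ℂ → V →L[ℂ] V) : Matrix (Fin d) (Fin d) ℂ →L[ℂ] V →L[ℂ] V :=
  fderiv ℂ Φ 1

/-! ### The Lie algebra representation and its exponential -/

namespace IsEntireExtension

variable {d : ℕ} {V : Type*} [NormedAddCommGroup V] [InnerProductSpace ℂ V]
  {ρ : Representation ℂ (SU d) V} {Φ : Matrix (Fin d) (Fin d) ℂ → V →L[ℂ] V}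

theorem hasDerivAt_comp (hΦ : IsEntireExtension ρ Φ) {γ : ℂ → Matrix (Fin d) (Fin d) ℂ}
    {γ' : Matrix (Fin d) (Fin d) ℂ} (hγ : HasDerivAt γ γ' 0) (h1 : γ 0 = 1) :
    HasDerivAt (fun t => Φ (γ t)) (lieMap Φ γ') 0 := by
  refine HasFDerivAt.comp_hasDerivAt (l := Φ) (f := γ) 0 ?_ hγ
  rw [h1]
  exact (hΦ.differentiable 1).hasFDerivAt

theorem hasDerivAt_exp_smul (X : Matrix (Fin d) (Fin d) ℂ) :
    HasDerivAt (fun t : ℂ => NormedSpace.exp (t • X)) X 0 := by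
  have h := hasDerivAt_exp_smul_const (𝕂 := ℂ) X 0
  simp only [zero_smul, NormedSpace.exp_zero, one_mul] at h
  exact h

variable [FiniteDimensional ℂ V]

theorem conj_lieMap (hΦ : IsEntireExtension ρ Φ) {A B X : Matrix (Fin d) (Fin d) ℂ}
    (hA : A.det = 1) (hB : B.det = 1) (hAB : A * B = 1) (htr : X.trace = 0) :
    Φ A * lieMap Φ X * Φ B = lieMap Φ (A * X * B) := by
  have h1 : HasDerivAt (fun t : ℂ => Φ (A * NormedSpace.exp (t • X) * B))
      (lieMap Φ (A * X * B)) 0 := by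
    refine hΦ.hasDerivAt_comp (((hasDerivAt_exp_smul X).const_mul A).mul_const B) ?_
    simp [hAB]
  have h2 : HasDerivAt (fun t : ℂ => Φ A * Φ (NormedSpace.exp (t • X)) * Φ B)
      (Φ A * lieMap Φ X * Φ B) 0 :=
    ((hΦ.hasDerivAt_comp (hasDerivAt_exp_smul X) (by simp)).const_mul _).mul_const _
  refine h2.unique (h1.congr_of_eventuallyEq (.of_forall fun t => ?_))
  have he : (NormedSpace.exp (t • X)).det = 1 := det_exp_of_trace_eq_zero (by simp [htr])
  simp only
  rw [hΦ.map_mul (by rw [Matrix.det_mul, hA, he, one_mul]) hB, hΦ.map_mul hA he]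

/-- This is the derivative at t = 0 of `conj_lieMap` with A = exp(tX) and B = exp(-tX). -/
theorem lieMap_commutator (hΦ : IsEntireExtension ρ Φ) {X Y : Matrix (Fin d) (Fin d) ℂ}
    (hX : X.trace = 0) (hY : Y.trace = 0) :
    lieMap Φ X * lieMap Φ Y - lieMap Φ Y * lieMap Φ X = lieMap Φ (X * Y - Y * X) := by
  have hneg : HasDerivAt (fun t : ℂ => NormedSpace.exp (t • -X)) (-X) 0 := hasDerivAt_exp_smul _
  have h1 := ((hΦ.hasDerivAt_comp (hasDerivAt_exp_smul X) (by simp)).mul_const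
    (lieMap Φ Y)).mul (hΦ.hasDerivAt_comp hneg (by simp))
  have h2 := (lieMap Φ).hasFDerivAt.comp_hasDerivAt (0 : ℂ)
    (((hasDerivAt_exp_smul X).mul_const Y).mul hneg)
  have h3 := h1.unique (h2.congr_of_eventuallyEq (.of_forall fun t => ?_))
  · simp only [zero_smul, NormedSpace.exp_zero, hΦ.map_one, one_mul, mul_one, map_neg, mul_neg,
      ← sub_eq_add_neg] at h3
    exact h3
  · have hx : (t • X).trace = 0 := by simp [hX]
    have hx' : (t • -X).trace = 0 := by simp [hX]
    refine hΦ.conj_lieMap (det_exp_of_trace_eq_zero hx) (det_exp_of_trace_eq_zero hx') ?_ hY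
    rw [smul_neg, ← Matrix.exp_add_of_commute _ _ (Commute.refl (t • X)).neg_right, add_neg_cancel,
      NormedSpace.exp_zero]

theorem hasDerivAt_exp_smul_at (hΦ : IsEntireExtension ρ Φ) {X : Matrix (Fin d) (Fin d) ℂ}
    (hX : X.trace = 0) (t : ℂ) :
    HasDerivAt (fun s : ℂ => Φ (NormedSpace.exp (s • X)))
      (Φ (NormedSpace.exp (t • X)) * lieMap Φ X) t := by
  have h1 := (hΦ.hasDerivAt_comp (hasDerivAt_exp_smul X) (by simp)).const_mul
    (Φ (NormedSpace.exp (t • X)))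
  rw [← sub_self t] at h1
  refine (HasDerivAt.comp_sub_const t t h1).congr_of_eventuallyEq (.of_forall fun s => ?_)
  simp only
  have hx : ∀ s : ℂ, (NormedSpace.exp (s • X)).det = 1 := fun s =>
    det_exp_of_trace_eq_zero (by simp [hX])
  rw [← hΦ.map_mul (hx _) (hx _), ← Matrix.exp_add_of_commute, ← add_smul, add_sub_cancel]
  exact ((Commute.refl X).smul_left t).smul_right (s - t)

theorem map_exp (hΦ : IsEntireExtension ρ Φ) {X : Matrix (Fin d) (Fin d) ℂ} (hX : X.trace = 0) :
    Φ (NormedSpace.exp X) = NormedSpace.exp (lieMap Φ X) := by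
  have := FiniteDimensional.complete ℂ V
  -- Both one-parameter groups have the same generator, so the product of one with the inverse of
  -- the other is constant.
  have h : ∀ t : ℂ, HasDerivAt (fun s : ℂ =>
      Φ (NormedSpace.exp (s • X)) * NormedSpace.exp (s • -lieMap Φ X)) 0 t := by
    intro t
    have h1 := (hΦ.hasDerivAt_exp_smul_at hX t).mul
      (hasDerivAt_exp_smul_const' (𝕂 := ℂ) (-lieMap Φ X) t)
    refine h1.congr_deriv ?_
    rw [mul_assoc, neg_mul, mul_neg, add_neg_cancel]
  have h2 := is_const_of_deriv_eq_zero (fun t => (h t).differentiableAt) (fun t => (h t).deriv) 1 0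
  simp only [one_smul, zero_smul, NormedSpace.exp_zero, hΦ.map_one, mul_one] at h2
  have h3 : NormedSpace.exp (-lieMap Φ X) * NormedSpace.exp (lieMap Φ X) = 1 := by
    let := NormedAlgebra.restrictScalars ℚ ℂ (V →L[ℂ] V)
    rw [← NormedSpace.exp_add_of_commute (Commute.refl (lieMap Φ X)).neg_left, neg_add_cancel,
      NormedSpace.exp_zero]
  calc _ = Φ (NormedSpace.exp X) * (NormedSpace.exp (-lieMap Φ X) *
        NormedSpace.exp (lieMap Φ X)) := by rw [h3, mul_one]
    _ = _ := by rw [← mul_assoc, h2, one_mul]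

theorem exp_apply_mem {T : V →L[ℂ] V} {U : Submodule ℂ V} (hU : ∀ u ∈ U, T u ∈ U) {u : V}
    (hu : u ∈ U) : NormedSpace.exp T u ∈ U := by
  have := FiniteDimensional.complete ℂ V
  have hs := (NormedSpace.exp_series_hasSum_exp' (𝕂 := ℂ) T).mapL
    (ContinuousLinearMap.apply ℂ V u)
  refine U.closed_of_finiteDimensional.mem_of_tendsto hs (.of_forall fun s => ?_)
  refine U.sum_mem fun n _ => ?_
  have : ∀ n, (T ^ n) u ∈ U := by
    intro n
    induction n with
    | zero => simpa using hu
    | succ n ih => rw [pow_succ']; exact hU _ ih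
  exact U.smul_mem _ (this n)

/-- A subspace that is invariant under the Lie algebra is invariant under the group. -/
theorem map_mem_of_lieMap_mem (hΦ : IsEntireExtension ρ Φ) {U : Submodule ℂ V}
    (hU : ∀ X : Matrix (Fin d) (Fin d) ℂ, X.trace = 0 → ∀ u ∈ U, lieMap Φ X u ∈ U)
    (g : SU d) {u : V} (hu : u ∈ U) : ρ g u ∈ U := by
  have key : ∀ N ∈ expMonoid d, Φ N u ∈ U := by
    intro N hN
    induction hN using Submonoid.closure_induction_left with
    | one => rw [hΦ.map_one]; exact hu
    | mul_left A hA M hM ih =>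
      obtain ⟨X, htr, rfl⟩ := hA
      rw [hΦ.map_exp_mul htr hM, hΦ.map_exp htr]
      exact exp_apply_mem (hU X htr) ih
  rw [← hΦ.apply_coe]
  exact key _ (mem_expMonoid_of_det_eq_one (SU.det_coe g))

end IsEntireExtension

/-! ### Weights -/

/-- A strictly dominant coweight of `SU(d)`: a decreasing real vector with sum zero. -/
def coweight (d : ℕ) (k : Fin d) : ℝ := (d : ℝ) - 1 - 2 * (k : ℕ)

theorem sum_coweight (d : ℕ) : ∑ k, coweight d k = 0 := by
  have h : (∑ k : Fin d, ((k : ℕ) : ℝ)) * 2 = d * (d - 1) := by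
    rw [Fin.sum_univ_eq_sum_range (fun k => (k : ℝ))]
    induction d with
    | zero => simp
    | succ n ih => rw [Finset.sum_range_succ, add_mul, ih]; push_cast; ring
  simp only [coweight, Finset.sum_sub_distrib, ← Finset.mul_sum]
  simp
  linarith

theorem coweight_lt {d : ℕ} {i j : Fin d} (h : i < j) : coweight d j < coweight d i := by
  have : ((i : ℕ) : ℝ) < (j : ℕ) := by exact_mod_cast h
  unfold coweight
  linarith

/-- The pairing of a weight with the strictly dominant coweight. -/
def weightLevel {d : ℕ} (w : Fin d → ℤ) : ℝ := ∑ k, (w k : ℝ) * coweight d k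

theorem weightLevel_add {d : ℕ} (w w' : Fin d → ℤ) :
    weightLevel (w + w') = weightLevel w + weightLevel w' := by
  simp [weightLevel, add_mul, Finset.sum_add_distrib]

theorem weightLevel_root {d : ℕ} (w : Fin d → ℤ) (i j : Fin d) :
    weightLevel (w + Pi.single i 1 - Pi.single j 1) =
      weightLevel w + coweight d i - coweight d j := by
  simp [weightLevel, sub_mul, add_mul, Finset.sum_add_distrib, Finset.sum_sub_distrib,
    Pi.single_apply]

theorem sum_simpleRoot_mul_coweight {d i : ℕ} (hi : i < d - 1) :
    ∑ j, simpleRoot d i j * coweight d j = 2 := by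
  have h0 : i < d := by omega
  have h1 : i + 1 < d := by omega
  have h : ∀ j : Fin d, simpleRoot d i j * coweight d j =
      (if j = ⟨i, h0⟩ then coweight d j else 0) - if j = ⟨i + 1, h1⟩ then coweight d j else 0 := by
    intro j
    simp only [simpleRoot, Fin.ext_iff]
    split_ifs <;> first | omega | simp
  rw [Finset.sum_congr rfl fun j _ => h j]
  simp only [Finset.sum_sub_distrib, Finset.sum_ite_eq', Finset.mem_univ, if_true]
  simp only [coweight]
  push_cast
  ring

/-- Every simple root pairs to 2 with the coweight, and (1, …, 1) pairs to 0. The level thus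
replaces the partial order by a real number that ignores the ambiguity of weights. -/
theorem WeightLE.weightLevel_le {d : ℕ} {w w' : Fin d → ℤ} (h : WeightLE w w') :
    weightLevel w ≤ weightLevel w' := by
  obtain ⟨n, c, hn, hnc⟩ := h
  have : weightLevel w' - weightLevel w = ∑ i ∈ Finset.range (d - 1), n i * 2 := by
    calc weightLevel w' - weightLevel w = ∑ j, ((w' j : ℝ) - w j) * coweight d j := by
          simp [weightLevel, sub_mul, Finset.sum_sub_distrib]
      _ = ∑ j, ((∑ i ∈ Finset.range (d - 1), n i * simpleRoot d i j) + c) * coweight d j := by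
          simp only [hnc]
      _ = ∑ i ∈ Finset.range (d - 1), n i * ∑ j, simpleRoot d i j * coweight d j := by
          simp only [add_mul, Finset.sum_add_distrib, ← Finset.mul_sum, sum_coweight, mul_zero,
            add_zero, Finset.sum_mul, mul_assoc]
          rw [Finset.sum_comm]
          simp only [Finset.mul_sum]
      _ = _ := Finset.sum_congr rfl fun i hi => by
          rw [sum_simpleRoot_mul_coweight (Finset.mem_range.1 hi)]
  have h2 : 0 ≤ ∑ i ∈ Finset.range (d - 1), n i * 2 :=
    Finset.sum_nonneg fun i _ => mul_nonneg (hn i) zero_le_two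
  linarith

/-- The element `diag(exp(i s a₁), …, exp(i s a_d))` of the maximal torus. -/
noncomputable def SU.torus {d : ℕ} (a : Fin d → ℝ) (ha : ∑ k, a k = 0) (s : ℝ) : SU d :=
  SU.exp ((s : ℂ) • Matrix.diagonal fun k => Complex.I * (a k : ℂ))
    (by
      rw [star_smul, Matrix.star_eq_conjTranspose, Matrix.diagonal_conjTranspose, ← smul_neg,
        Matrix.diagonal_neg, Complex.star_def, Complex.conj_ofReal]
      congr 2
      funext k
      simp)
    (by
      rw [Matrix.trace_smul, Matrix.trace_diagonal, ← Finset.mul_sum]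
      have : (∑ k, (a k : ℂ)) = 0 := by exact_mod_cast congrArg Complex.ofReal ha
      rw [this]; simp)

theorem SU.coe_torus {d : ℕ} (a : Fin d → ℝ) (ha : ∑ k, a k = 0) (s : ℝ) :
    (SU.torus a ha s : Matrix (Fin d) (Fin d) ℂ) =
      Matrix.diagonal fun k => Complex.exp ((s * a k : ℝ) * Complex.I) := by
  change NormedSpace.exp ((s : ℂ) • Matrix.diagonal fun k => Complex.I * (a k : ℂ)) = _
  rw [← Matrix.diagonal_smul, Matrix.exp_diagonal]
  congr 1
  funext k
  rw [Pi.coe_exp, Complex.exp_eq_exp_ℂ]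
  congr 1
  simp
  ring

theorem IsWeightVector.torus_apply {d : ℕ} {V : Type*} [AddCommGroup V] [Module ℂ V]
    {ρ : Representation ℂ (SU d) V} {w : Fin d → ℤ} {v : V} (hv : IsWeightVector ρ w v)
    (a : Fin d → ℝ) (ha : ∑ k, a k = 0) (s : ℝ) :
    ρ (SU.torus a ha s) v = Complex.exp ((s * ∑ k, (w k : ℝ) * a k : ℝ) * Complex.I) • v := by
  rw [hv _ (by rw [SU.coe_torus]; exact Matrix.isDiag_diagonal _)]
  congr 1
  simp only [SU.coe_torus, Matrix.diagonal_apply_eq, ← Complex.exp_int_mul, ← Complex.exp_sum]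
  congr 1
  push_cast
  rw [Finset.mul_sum, Finset.sum_mul]
  exact Finset.sum_congr rfl fun k _ => by ring

/-- Weight vectors whose weights have different levels are orthogonal. -/
theorem IsWeightVector.inner_eq_zero {d : ℕ} {V : Type*} [NormedAddCommGroup V]
    [InnerProductSpace ℂ V] {ρ : Representation ℂ (SU d) V}
    (hρ : ∀ (g : SU d) (x y : V), inner ℂ (ρ g x) (ρ g y) = inner ℂ x y)
    {w w' : Fin d → ℤ} {v v' : V} (hv : IsWeightVector ρ w v) (hv' : IsWeightVector ρ w' v')
    (hne : weightLevel w ≠ weightLevel w') : inner ℂ v v' = 0 := by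
  have hs : weightLevel w' - weightLevel w ≠ 0 := sub_ne_zero.2 hne.symm
  -- At this time the relative phase of the two vectors is exp(iπ) = -1, so invariance makes the
  -- inner product equal to its negative.
  have h := hρ (SU.torus (coweight d) (sum_coweight d)
    (Real.pi / (weightLevel w' - weightLevel w))) v v'
  rw [hv.torus_apply, hv'.torus_apply, inner_smul_left, inner_smul_right, ← mul_assoc,
    ← Complex.exp_conj, ← Complex.exp_add] at h
  change Complex.exp ((starRingEnd ℂ) (((_ * weightLevel w : ℝ) : ℂ) * Complex.I) +
    ((_ * weightLevel w' : ℝ) : ℂ) * Complex.I) * _ = _ at h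
  have he : (starRingEnd ℂ) (((Real.pi / (weightLevel w' - weightLevel w) * weightLevel w : ℝ) : ℂ)
      * Complex.I) + ((Real.pi / (weightLevel w' - weightLevel w) * weightLevel w' : ℝ) : ℂ) *
      Complex.I = Real.pi * Complex.I := by
    rw [_root_.map_mul, Complex.conj_ofReal, Complex.conj_I, mul_neg, ← neg_mul, ← add_mul,
      ← Complex.ofReal_neg, ← Complex.ofReal_add]
    congr 2
    field_simp
    ring
  rw [he, Complex.exp_pi_mul_I, neg_one_mul] at h
  exact self_eq_neg.1 h.symm

theorem SU.eq_diagonal {d : ℕ} {h : SU d} (hh : (h : Matrix (Fin d) (Fin d) ℂ).IsDiag) :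
    (h : Matrix (Fin d) (Fin d) ℂ) = Matrix.diagonal fun k => h.1 k k :=
  hh.diagonal_diag.symm

theorem SU.diag_ne_zero {d : ℕ} {h : SU d} (hh : (h : Matrix (Fin d) (Fin d) ℂ).IsDiag)
    (k : Fin d) : h.1 k k ≠ 0 := by
  intro h0
  have := SU.det_coe h
  rw [SU.eq_diagonal hh, Matrix.det_diagonal, Finset.prod_eq_zero (f := fun i => h.1 i i)
    (Finset.mem_univ k) h0] at this
  exact zero_ne_one this

theorem SU.star_diag {d : ℕ} {h : SU d} (hh : (h : Matrix (Fin d) (Fin d) ℂ).IsDiag)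
    (k : Fin d) : star (h.1 k k) = (h.1 k k)⁻¹ := by
  have := congrFun (congrFun (SU.mul_star_self h) k) k
  rw [SU.eq_diagonal hh, Matrix.star_eq_conjTranspose, Matrix.diagonal_conjTranspose,
    Matrix.diagonal_mul_diagonal, Matrix.diagonal_apply_eq, Matrix.one_apply_eq] at this
  exact eq_inv_of_mul_eq_one_right this

/-! ### Action of the Lie algebra on weight vectors -/

section LieWeights

variable {d : ℕ} {V : Type*} [NormedAddCommGroup V] [InnerProductSpace ℂ V]
  {ρ : Representation ℂ (SU d) V} {Φ : Matrix (Fin d) (Fin d) ℂ → V →L[ℂ] V}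

/-- Matrix units act as root vectors. -/
theorem IsWeightVector.lieMap_single [FiniteDimensional ℂ V] (hΦ : IsEntireExtension ρ Φ) {w : Fin d → ℤ} {v : V}
    (hv : IsWeightVector ρ w v) {i j : Fin d} (hij : i ≠ j) :
    IsWeightVector ρ (w + Pi.single i 1 - Pi.single j 1) (lieMap Φ (Matrix.single i j 1) v) := by
  intro h hh
  have hB : (star h.1 : Matrix (Fin d) (Fin d) ℂ).det = 1 := SU.det_coe h⁻¹
  have hconj : h.1 * Matrix.single i j 1 * star h.1 =
      (h.1 i i * (h.1 j j)⁻¹) • Matrix.single i j (1 : ℂ) := by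
    rw [← SU.star_diag hh j]
    conv_lhs => rw [SU.eq_diagonal hh]
    rw [Matrix.star_eq_conjTranspose, Matrix.diagonal_conjTranspose]
    ext k l
    rw [Matrix.mul_diagonal, Matrix.diagonal_mul, Matrix.smul_apply, Matrix.single_apply]
    split_ifs with hkl
    · obtain ⟨rfl, rfl⟩ := hkl; simp
    · simp
  have h1 := hΦ.conj_lieMap (SU.det_coe h) hB (SU.mul_star_self h)
    (Matrix.trace_single_eq_of_ne i j (1 : ℂ) hij)
  have h2 := congrArg (fun T : V →L[ℂ] V => T (ρ h v)) h1
  have h3 : Φ (star h.1) (ρ h v) = v := by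
    have := hΦ.apply_coe h⁻¹ (ρ h v)
    rw [Representation.inv_self_apply] at this
    exact this
  simp only [mul_apply_eq_comp, h3, hΦ.apply_coe] at h2
  rw [h2, hconj, hv h hh, map_smul, map_smul, smul_apply, smul_smul]
  congr 1
  have h4 : ∀ k, h.1 k k ^ (w + Pi.single i 1 - Pi.single j 1 : Fin d → ℤ) k =
      h.1 k k ^ w k * ((if k = i then h.1 k k else 1) * if k = j then (h.1 k k)⁻¹ else 1) := by
    intro k
    have hk := SU.diag_ne_zero hh k
    rw [Pi.sub_apply, Pi.add_apply, zpow_sub₀ hk, zpow_add₀ hk]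
    rcases eq_or_ne k i with rfl | hi
    · simp [hij]
    · rcases eq_or_ne k j with rfl | hj
      · simp [hi, div_eq_mul_inv]
      · simp [hi, hj]
  simp only [h4, Finset.prod_mul_distrib, Finset.prod_ite_eq', Finset.mem_univ, if_true]

/-- Traceless diagonal matrices act on weight vectors as scalars. -/
theorem IsWeightVector.exists_lieMap_diagonal (hΦ : IsEntireExtension ρ Φ) {w : Fin d → ℤ} {v : V}
    (hv : IsWeightVector ρ w v) {a : Fin d → ℂ} (ha : ∑ k, a k = 0) :
    ∃ c : ℂ, lieMap Φ (Matrix.diagonal a) v = c • v := by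
  have key : ∀ b : Fin d → ℝ, ∑ k, b k = 0 →
      ∃ c : ℂ, lieMap Φ (Matrix.diagonal fun k => (b k : ℂ)) v = c • v := by
    intro b hb
    have h1 := (hΦ.hasDerivAt_comp (IsEntireExtension.hasDerivAt_exp_smul
      (Matrix.diagonal fun k => Complex.I * (b k : ℂ))) (by simp))
    have h2 := ((ContinuousLinearMap.apply ℂ V v).hasFDerivAt.comp_hasDerivAt (0 : ℂ) h1)
    -- The weight describes the action of the compact torus only, so the derivative is restricted to
    -- real times and compared with that of the phase.
    have h2' := HasDerivAt.scomp (0 : ℝ) (h := fun s : ℝ => (s : ℂ)) (by simpa using h2)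
      Complex.ofRealCLM.hasDerivAt
    let r : ℝ := ∑ k, (w k : ℝ) * b k
    have h3 : HasDerivAt (fun s : ℝ => Complex.exp ((s * r : ℝ) * Complex.I) • v)
        ((Complex.I * r) • v) 0 := by
      have : HasDerivAt (fun s : ℂ => Complex.exp (s * (r * Complex.I))) (Complex.I * r) 0 := by
        have h5 := ((hasDerivAt_id (0 : ℂ)).mul_const (r * Complex.I)).cexp
        simpa [mul_comm] using h5
      have h6 := (HasDerivAt.comp_ofReal (z := 0) (this)).smul_const v
      refine h6.congr_of_eventuallyEq (.of_forall fun s => ?_)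
      simp [mul_assoc]
    have h4 := h2'.unique (h3.congr_of_eventuallyEq (.of_forall fun s => ?_))
    · rw [Complex.ofRealCLM_apply, Complex.ofReal_one, one_smul] at h4
      have h7 : (Matrix.diagonal fun k => (b k : ℂ)) =
          (-Complex.I) • Matrix.diagonal fun k => Complex.I * (b k : ℂ) := by
        rw [← Matrix.diagonal_smul]
        congr 1
        funext k
        simp [← mul_assoc]
      refine ⟨-Complex.I * (Complex.I * r), ?_⟩
      rw [h7, map_smul, smul_apply, mul_smul]
      exact congrArg _ h4
    · simp only
      rw [← hv.torus_apply b hb s]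
      exact hΦ.apply_coe (SU.torus b hb s) v
  have hre : ∑ k, (a k).re = 0 := by simpa using congrArg Complex.re ha
  have him : ∑ k, (a k).im = 0 := by simpa using congrArg Complex.im ha
  obtain ⟨c, hc⟩ := key _ hre
  obtain ⟨c', hc'⟩ := key _ him
  refine ⟨c + Complex.I * c', ?_⟩
  have h8 : Matrix.diagonal a = (Matrix.diagonal fun k => ((a k).re : ℂ)) +
      Complex.I • Matrix.diagonal fun k => ((a k).im : ℂ) := by
    rw [← Matrix.diagonal_smul, Matrix.diagonal_add]
    congr 1
    funext k
    simp [mul_comm Complex.I, Complex.re_add_im]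
  rw [h8, map_add, map_smul, add_apply, smul_apply, hc,
    hc', add_smul, mul_smul]

end LieWeights

/-! ### Irreducible representations are generated from the highest weight by lowering operators -/

section HighestWeight

variable {d : ℕ} {V : Type*} [NormedAddCommGroup V] [InnerProductSpace ℂ V]
  {ρ : Representation ℂ (SU d) V} {Φ : Matrix (Fin d) (Fin d) ℂ → V →L[ℂ] V}

/-- The span of the weight vectors whose weight has level less than `l`. -/
def lowerWeightSpan (ρ : Representation ℂ (SU d) V) (l : ℝ) : Submodule ℂ V :=
  Submodule.span ℂ {u | ∃ w, IsWeightVector ρ w u ∧ weightLevel w < l}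

/-- The span of the vectors obtained from `v` by at most `n` lowering operators. -/
noncomputable def loweredSpan (Φ : Matrix (Fin d) (Fin d) ℂ → V →L[ℂ] V) (v : V) :
    ℕ → Submodule ℂ V
  | 0 => Submodule.span ℂ {v}
  | n + 1 => loweredSpan Φ v n ⊔ Submodule.span ℂ
      {x | ∃ Y : Matrix (Fin d) (Fin d) ℂ, (∀ i j, i ≤ j → Y i j = 0) ∧
        ∃ u ∈ loweredSpan Φ v n, lieMap Φ Y u = x}

theorem loweredSpan_le_succ (v : V) (n : ℕ) : loweredSpan Φ v n ≤ loweredSpan Φ v (n + 1) :=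
  le_sup_left

theorem lieMap_lower_mem_loweredSpan {v : V} {n : ℕ} {Y : Matrix (Fin d) (Fin d) ℂ}
    (hY : ∀ i j, i ≤ j → Y i j = 0) {u : V} (hu : u ∈ loweredSpan Φ v n) :
    lieMap Φ Y u ∈ loweredSpan Φ v (n + 1) :=
  Submodule.mem_sup_right (Submodule.subset_span ⟨Y, hY, u, hu, rfl⟩)

theorem Matrix.exists_lower_add_upper {X : Matrix (Fin d) (Fin d) ℂ} (hX : X.trace = 0) :
    ∃ L U : Matrix (Fin d) (Fin d) ℂ, X = L + U ∧ (∀ i j, i ≤ j → L i j = 0) ∧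
      (∀ i j, j < i → U i j = 0) ∧ U.trace = 0 := by
  refine ⟨Matrix.of fun i j => if i ≤ j then 0 else X i j,
    Matrix.of fun i j => if i ≤ j then X i j else 0, ?_, ?_, ?_, ?_⟩
  · ext i j
    by_cases h : i ≤ j <;> simp [h]
  · intro i j h
    simp [h]
  · intro i j h
    simp [not_le.2 h]
  · rw [← hX]
    simp [Matrix.trace]

theorem lieMap_eq_sum (X : Matrix (Fin d) (Fin d) ℂ) (v : V) :
    lieMap Φ X v = ∑ i, ∑ j, X i j • lieMap Φ (Matrix.single i j 1) v := by
  conv_lhs => rw [Matrix.matrix_eq_sum_single X]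
  simp only [map_sum, sum_apply]
  refine Finset.sum_congr rfl fun i _ => Finset.sum_congr rfl fun j _ => ?_
  rw [← smul_apply, ← map_smul, Matrix.smul_single, smul_eq_mul, mul_one]

variable [FiniteDimensional ℂ V]

theorem IsWeightVector.lieMap_lower_mem (hΦ : IsEntireExtension ρ Φ) {w : Fin d → ℤ} {v : V}
    (hv : IsWeightVector ρ w v) {Y : Matrix (Fin d) (Fin d) ℂ} (hY : ∀ i j, i ≤ j → Y i j = 0)
    {l : ℝ} (hl : weightLevel w ≤ l) : lieMap Φ Y v ∈ lowerWeightSpan ρ l := by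
  rw [lieMap_eq_sum]
  refine Submodule.sum_mem _ fun i _ => Submodule.sum_mem _ fun j _ => ?_
  rcases le_or_gt i j with h | h
  · rw [hY i j h, zero_smul]
    exact Submodule.zero_mem _
  · refine Submodule.smul_mem _ _ (Submodule.subset_span ⟨_, hv.lieMap_single hΦ h.ne', ?_⟩)
    rw [weightLevel_root]
    linarith [coweight_lt h]

theorem loweredSpan_le (hΦ : IsEntireExtension ρ Φ) {w : Fin d → ℤ} {v : V}
    (hv : IsWeightVector ρ w v) (n : ℕ) :
    loweredSpan Φ v n ≤ Submodule.span ℂ {v} ⊔ lowerWeightSpan ρ (weightLevel w) := by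
  induction n with
  | zero => exact le_sup_left
  | succ n ih =>
    refine sup_le ih (Submodule.span_le.2 ?_)
    rintro _ ⟨Y, hY, u, hu, rfl⟩
    refine Submodule.mem_sup_right ?_
    have : Submodule.span ℂ {v} ⊔ lowerWeightSpan ρ (weightLevel w) ≤
        (lowerWeightSpan ρ (weightLevel w)).comap (lieMap Φ Y).toLinearMap := by
      refine sup_le (Submodule.span_le.2 ?_) (Submodule.span_le.2 ?_)
      · rintro _ rfl
        exact hv.lieMap_lower_mem hΦ hY le_rfl
      · rintro x ⟨w', hx, hw'⟩
        exact hx.lieMap_lower_mem hΦ hY hw'.le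
    exact this (ih hu)

/-- A nonzero image would have weight μ + e_i - e_j, whose level exceeds that of μ when i < j. -/
theorem IsHighestWeight.lieMap_single_eq_zero (hΦ : IsEntireExtension ρ Φ) {μ : Fin d → ℤ}
    (hμ : IsHighestWeight ρ μ) {v : V} (hv : IsWeightVector ρ μ v) {i j : Fin d} (hij : i < j) :
    lieMap Φ (Matrix.single i j 1) v = 0 := by
  by_contra h0
  have := (hμ.2 _ ⟨_, h0, hv.lieMap_single hΦ hij.ne⟩).weightLevel_le
  rw [weightLevel_root] at this
  linarith [coweight_lt hij]

theorem IsHighestWeight.exists_lieMap_upper (hΦ : IsEntireExtension ρ Φ) {μ : Fin d → ℤ}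
    (hμ : IsHighestWeight ρ μ) {v : V} (hv : IsWeightVector ρ μ v)
    {X : Matrix (Fin d) (Fin d) ℂ} (hX : ∀ i j, j < i → X i j = 0) (htr : X.trace = 0) :
    ∃ c : ℂ, lieMap Φ X v = c • v := by
  obtain ⟨c, hc⟩ := hv.exists_lieMap_diagonal hΦ (a := fun k => X k k) htr
  refine ⟨c, ?_⟩
  rw [← hc, lieMap_eq_sum X, lieMap_eq_sum (Matrix.diagonal _)]
  refine Finset.sum_congr rfl fun i _ => Finset.sum_congr rfl fun j _ => ?_
  rcases lt_trichotomy i j with h | rfl | h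
  · rw [hμ.lieMap_single_eq_zero hΦ hv h, smul_zero, smul_zero]
  · rw [Matrix.diagonal_apply_eq]
  · rw [hX i j h, Matrix.diagonal_apply_ne _ h.ne']

/-- For X upper triangular and Y strictly lower, XYu = YXu + [X, Y]u. The commutator is traceless
but not triangular, so the induction must carry the second claim, for arbitrary traceless matrices,
along with the first. -/
theorem IsHighestWeight.lieMap_mem_loweredSpan (hΦ : IsEntireExtension ρ Φ) {μ : Fin d → ℤ}
    (hμ : IsHighestWeight ρ μ) {v : V} (hv : IsWeightVector ρ μ v) (n : ℕ) :
    (∀ X : Matrix (Fin d) (Fin d) ℂ, (∀ i j, j < i → X i j = 0) → X.trace = 0 →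
      ∀ u ∈ loweredSpan Φ v n, lieMap Φ X u ∈ loweredSpan Φ v n) ∧
    (∀ X : Matrix (Fin d) (Fin d) ℂ, X.trace = 0 →
      ∀ u ∈ loweredSpan Φ v n, lieMap Φ X u ∈ loweredSpan Φ v (n + 1)) := by
  have step : ∀ n, (∀ X : Matrix (Fin d) (Fin d) ℂ, (∀ i j, j < i → X i j = 0) → X.trace = 0 →
      ∀ u ∈ loweredSpan Φ v n, lieMap Φ X u ∈ loweredSpan Φ v n) →
      ∀ X : Matrix (Fin d) (Fin d) ℂ, X.trace = 0 →
        ∀ u ∈ loweredSpan Φ v n, lieMap Φ X u ∈ loweredSpan Φ v (n + 1) := by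
    intro n h X hX u hu
    obtain ⟨L, U, rfl, hL, hU, htr⟩ := Matrix.exists_lower_add_upper hX
    rw [map_add, add_apply]
    exact Submodule.add_mem _ (lieMap_lower_mem_loweredSpan hL hu)
      (loweredSpan_le_succ v n (h U hU htr u hu))
  induction n with
  | zero =>
    have h0 : ∀ X : Matrix (Fin d) (Fin d) ℂ, (∀ i j, j < i → X i j = 0) → X.trace = 0 →
        ∀ u ∈ loweredSpan Φ v 0, lieMap Φ X u ∈ loweredSpan Φ v 0 := by
      intro X hX htr u hu
      obtain ⟨c, hc⟩ := hμ.exists_lieMap_upper hΦ hv hX htr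
      obtain ⟨r, rfl⟩ := Submodule.mem_span_singleton.1 hu
      rw [map_smul, hc]
      exact Submodule.smul_mem _ _ (Submodule.smul_mem _ _ (Submodule.mem_span_singleton_self v))
    exact ⟨h0, step 0 h0⟩
  | succ n ih =>
    have h1 : ∀ X : Matrix (Fin d) (Fin d) ℂ, (∀ i j, j < i → X i j = 0) → X.trace = 0 →
        ∀ u ∈ loweredSpan Φ v (n + 1), lieMap Φ X u ∈ loweredSpan Φ v (n + 1) := by
      intro X hX htr
      have : loweredSpan Φ v (n + 1) ≤
          (loweredSpan Φ v (n + 1)).comap (lieMap Φ X).toLinearMap := by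
        refine sup_le (fun u hu => Submodule.mem_comap.2
          (loweredSpan_le_succ v n (ih.1 X hX htr u hu)))
          (Submodule.span_le.2 ?_)
        rintro _ ⟨Y, hY, u, hu, rfl⟩
        have hYtr : Y.trace = 0 := Finset.sum_eq_zero fun i _ => hY i i le_rfl
        have hc := congrArg (fun T : V →L[ℂ] V => T u) (hΦ.lieMap_commutator htr hYtr)
        simp only [sub_apply, mul_apply_eq_comp] at hc
        change lieMap Φ X (lieMap Φ Y u) ∈ loweredSpan Φ v (n + 1)
        rw [sub_eq_iff_eq_add.1 hc]
        refine Submodule.add_mem _ (ih.2 _ ?_ u hu)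
          (lieMap_lower_mem_loweredSpan hY (ih.1 X hX htr u hu))
        rw [Matrix.trace_sub, Matrix.trace_mul_comm, sub_self]
      exact this
    exact ⟨h1, step _ h1⟩

/-- An irreducible representation is spanned by a highest weight vector together with weight
vectors of strictly smaller weights. -/
theorem IsHighestWeight.span_sup_lowerWeightSpan (hρ : IsUnitaryRep ρ) (hirr : ρ.IsIrreducible)
    {μ : Fin d → ℤ} (hμ : IsHighestWeight ρ μ) {v : V} (hv : IsWeightVector ρ μ v) (hv0 : v ≠ 0) :
    Submodule.span ℂ {v} ⊔ lowerWeightSpan ρ (weightLevel μ) = ⊤ := by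
  obtain ⟨Φ, hΦd, hΦa⟩ := hρ.exists_entire_extension hirr
  have hΦ : IsEntireExtension ρ Φ := ⟨hΦd, hΦa⟩
  have hdir : Directed (· ≤ ·) (loweredSpan Φ v) :=
    (monotone_nat_of_le_succ (loweredSpan_le_succ v)).directed_le
  -- The Lie algebra moves each stage into the next, so the union is invariant under the Lie
  -- algebra, hence under the group.
  have htop : ⨆ n, loweredSpan Φ v n = ⊤ := by
    refine hirr.eq_top _ (fun g u hu => hΦ.map_mem_of_lieMap_mem ?_ g hu)
      (Submodule.mem_iSup_of_mem 0 (Submodule.mem_span_singleton_self v)) hv0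
    intro X hX u hu
    obtain ⟨n, hn⟩ := (Submodule.mem_iSup_of_directed _ hdir).1 hu
    exact Submodule.mem_iSup_of_mem (n + 1) ((hμ.lieMap_mem_loweredSpan hΦ hv n).2 X hX u hn)
  rw [eq_top_iff, ← htop]
  exact iSup_le (loweredSpan_le hΦ hv)

end HighestWeight

/-! ### Highest weight vectors in a tensor product -/

theorem IsWeightVector.tmul {d : ℕ} {V W : Type*} [AddCommGroup V] [Module ℂ V] [AddCommGroup W]
    [Module ℂ W] {ρ : Representation ℂ (SU d) V} {σ : Representation ℂ (SU d) W}
    {w w' : Fin d → ℤ} {v : V} {v' : W} (hv : IsWeightVector ρ w v) (hv' : IsWeightVector σ w' v') :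
    IsWeightVector (ρ.tprod σ) (w + w') (v ⊗ₜ[ℂ] v') := by
  intro h hh
  rw [Representation.tprod_apply, TensorProduct.map_tmul, hv h hh, hv' h hh,
    TensorProduct.smul_tmul_smul, ← Finset.prod_mul_distrib]
  congr 1
  exact Finset.prod_congr rfl fun k _ => (zpow_add₀ (SU.diag_ne_zero hh k) _ _).symm

section Tensor

variable {d : ℕ} {V W : Type*} [NormedAddCommGroup V] [InnerProductSpace ℂ V]
  [NormedAddCommGroup W] [InnerProductSpace ℂ W]
  {ρ : Representation ℂ (SU d) V} {σ : Representation ℂ (SU d) W}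

theorem TensorProduct.inner_smul_right (x y : V ⊗[ℂ] W) (c : ℂ) :
    inner ℂ x (c • y) = c * inner ℂ x y :=
  _root_.inner_smul_right (E := V ⊗[ℂ] W) x y c

theorem TensorProduct.inner_smul_left (x y : V ⊗[ℂ] W) (c : ℂ) :
    inner ℂ (c • x) y = (starRingEnd ℂ) c * inner ℂ x y :=
  _root_.inner_smul_left (E := V ⊗[ℂ] W) x y c

theorem IsUnitaryRep.tprod_inner (hρ : IsUnitaryRep ρ) (hσ : IsUnitaryRep σ) (g : SU d)
    (x y : V ⊗[ℂ] W) : inner ℂ (ρ.tprod σ g x) (ρ.tprod σ g y) = inner ℂ x y :=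
  TensorProduct.inner_map_map ((ρ g).isometryOfInner (hρ.inner_map_map g))
    ((σ g).isometryOfInner (hσ.inner_map_map g)) x y

/-- The tensor product of highest weight vectors lies in each subrepresentation that has the sum
of the highest weights as a weight. -/
theorem tmul_mem_of_isWeight [FiniteDimensional ℂ V] [FiniteDimensional ℂ W]
    (hρ : IsUnitaryRep ρ) (hρirr : ρ.IsIrreducible)
    (hσ : IsUnitaryRep σ) (hσirr : σ.IsIrreducible) {μ ν : Fin d → ℤ}
    (hμ : IsHighestWeight ρ μ) (hν : IsHighestWeight σ ν) {v : V} (hv : IsWeightVector ρ μ v)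
    (hv1 : ‖v‖ = 1) {w : W} (hw : IsWeightVector σ ν w) (hw1 : ‖w‖ = 1)
    {C : Subrepresentation (ρ.tprod σ)} (hC : IsWeight C.toRepresentation (μ + ν)) :
    v ⊗ₜ[ℂ] w ∈ C := by
  obtain ⟨⟨c, hcC⟩, hc0, hc⟩ := hC
  have hcw : IsWeightVector (ρ.tprod σ) (μ + ν) c := fun h hh => congrArg Subtype.val (hc h hh)
  have hlow : ∀ {a b : Fin d → ℤ} {x : V} {y : W}, IsWeightVector ρ a x → IsWeightVector σ b y →
      weightLevel a + weightLevel b < weightLevel μ + weightLevel ν → ∀ {z : V ⊗[ℂ] W},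
      IsWeightVector (ρ.tprod σ) (μ + ν) z → inner ℂ (x ⊗ₜ[ℂ] y) z = 0 := by
    intro a b x y hx hy hlt z hz
    refine (hx.tmul hy).inner_eq_zero (hρ.tprod_inner hσ) hz ?_
    rw [weightLevel_add, weightLevel_add]
    exact hlt.ne
  let r : ℂ := inner ℂ (v ⊗ₜ[ℂ] w) c
  -- The part of `c` orthogonal to v ⊗ w. It still has weight μ + ν, while all other products of
  -- spanning vectors have lower level and are orthogonal to it; so z = 0 and `c` is a nonzero
  -- multiple of v ⊗ w.
  let z : V ⊗[ℂ] W := c - r • v ⊗ₜ[ℂ] w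
  have hz : IsWeightVector (ρ.tprod σ) (μ + ν) z := by
    intro h hh
    rw [map_sub, map_smul, hcw h hh, hv.tmul hw h hh, smul_sub, smul_comm]
  have h1 : ∀ x y, inner ℂ (x ⊗ₜ[ℂ] y) z = 0 := by
    have hvw : inner ℂ (v ⊗ₜ[ℂ] w) z = 0 := by
      have h2 : inner ℂ (v ⊗ₜ[ℂ] w) (r • v ⊗ₜ[ℂ] w) = r * inner ℂ (v ⊗ₜ[ℂ] w) (v ⊗ₜ[ℂ] w) :=
        TensorProduct.inner_smul_right _ _ _
      simp only [z, inner_sub_right, h2, TensorProduct.inner_tmul, inner_self_eq_norm_sq_to_K, hv1,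
        hw1]
      simp [r]
    have hx : ∀ x y, (x = v ∨ ∃ a, IsWeightVector ρ a x ∧ weightLevel a < weightLevel μ) →
        (y = w ∨ ∃ b, IsWeightVector σ b y ∧ weightLevel b < weightLevel ν) →
        inner ℂ (x ⊗ₜ[ℂ] y) z = 0 := by
      rintro x y (rfl | ⟨a, ha, hla⟩) (rfl | ⟨b, hb, hlb⟩)
      · exact hvw
      · exact hlow hv hb (by linarith) hz
      · exact hlow ha hw (by linarith) hz
      · exact hlow ha hb (by linarith) hz
    intro x y
    have hxt : x ∈ Submodule.span ℂ ({v} ∪ {u | ∃ a, IsWeightVector ρ a u ∧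
        weightLevel a < weightLevel μ}) := by
      rw [Submodule.span_union]
      exact (hμ.span_sup_lowerWeightSpan hρ hρirr hv (norm_ne_zero_iff.1 (by simp [hv1]))).ge
        Submodule.mem_top
    have hyt : y ∈ Submodule.span ℂ ({w} ∪ {u | ∃ a, IsWeightVector σ a u ∧
        weightLevel a < weightLevel ν}) := by
      rw [Submodule.span_union]
      exact (hν.span_sup_lowerWeightSpan hσ hσirr hw (norm_ne_zero_iff.1 (by simp [hw1]))).ge
        Submodule.mem_top
    induction hxt using Submodule.span_induction with
    | mem x hxm =>
      induction hyt using Submodule.span_induction with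
      | mem y hym => exact hx x y hxm hym
      | zero => rw [TensorProduct.tmul_zero, inner_zero_left]
      | add y y' _ _ h h' => rw [TensorProduct.tmul_add, inner_add_left, h, h', add_zero]
      | smul c y _ h =>
        rw [TensorProduct.tmul_smul, TensorProduct.inner_smul_left, h, mul_zero]
    | zero => rw [TensorProduct.zero_tmul, inner_zero_left]
    | add x x' _ _ h h' => rw [TensorProduct.add_tmul, inner_add_left, h, h', add_zero]
    | smul c x _ h =>
      rw [← TensorProduct.smul_tmul', TensorProduct.inner_smul_left, h, mul_zero]
  have hz0 : z = 0 := by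
    refine TensorProduct.ext_iff_inner_left.2 fun x y => ?_
    rw [h1, inner_zero_right]
  have hcr : c = r • v ⊗ₜ[ℂ] w := sub_eq_zero.1 hz0
  have hr : r ≠ 0 := by
    intro h
    rw [h, zero_smul] at hcr
    exact hc0 (Subtype.ext hcr)
  have : v ⊗ₜ[ℂ] w = r⁻¹ • c := by rw [hcr, smul_smul, inv_mul_cancel₀ hr, one_smul]
  rw [this]
  exact C.toSubmodule.smul_mem _ hcC

end Tensor

end EntireExtension

/-! ### Schur orthogonality -/

theorem continuous_ketbra {E : Type*} [NormedAddCommGroup E] [InnerProductSpace ℂ E] :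
    Continuous (ketbra : E → E →L[ℂ] E) := by
  exact ((ContinuousLinearMap.smulRightL ℂ E E).continuous.comp
    (innerSL ℂ).continuous).clm_apply continuous_id

theorem ketbra_apply {E : Type*} [NormedAddCommGroup E] [InnerProductSpace ℂ E] (ψ x : E) :
    ketbra ψ x = inner ℂ ψ x • ψ := InnerProductSpace.rankOne_apply ..

theorem trace_ketbra {E : Type*} [NormedAddCommGroup E] [InnerProductSpace ℂ E]
    [FiniteDimensional ℂ E] (ψ : E) :
    LinearMap.trace ℂ E (ketbra ψ).toLinearMap = ((‖ψ‖ ^ 2 : ℝ) : ℂ) := by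
  rw [ketbra, InnerProductSpace.trace_rankOne, inner_self_eq_norm_sq_to_K]
  norm_cast

/-- The trace as a continuous linear functional. -/
noncomputable def traceCLM (E : Type*) [NormedAddCommGroup E] [InnerProductSpace ℂ E]
    [FiniteDimensional ℂ E] : (E →L[ℂ] E) →L[ℂ] ℂ :=
  LinearMap.toContinuousLinearMap (LinearMap.trace ℂ E ∘ₗ ContinuousLinearMap.coeLM ℂ)

theorem traceCLM_apply {E : Type*} [NormedAddCommGroup E] [InnerProductSpace ℂ E]
    [FiniteDimensional ℂ E] (A : E →L[ℂ] E) :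
    traceCLM E A = LinearMap.trace ℂ E A.toLinearMap := rfl

section Schur

variable {d : ℕ} {V : Type*} [NormedAddCommGroup V] [InnerProductSpace ℂ V]
  {ρ : Representation ℂ (SU d) V}

theorem IsUnitaryRep.integrable_ketbra (hρ : IsUnitaryRep ρ) (v : V) :
    Integrable (fun g => ketbra (ρ g v)) (SU.haar d) :=
  SU.integrable_haar (continuous_ketbra.comp (hρ.continuous_apply v))

theorem IsUnitaryRep.continuous_matrixCoeff_smul (hρ : IsUnitaryRep ρ) (v x : V) :
    Continuous fun g => inner ℂ (ρ g v) x • ρ g v :=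
  ((hρ.continuous_apply v).inner continuous_const).smul (hρ.continuous_apply v)

variable [FiniteDimensional ℂ V]

theorem IsUnitaryRep.integral_ketbra_apply (hρ : IsUnitaryRep ρ) (v x : V) :
    (∫ g, ketbra (ρ g v) ∂SU.haar d) x = ∫ g, inner ℂ (ρ g v) x • ρ g v ∂SU.haar d := by
  have := FiniteDimensional.complete ℂ V
  rw [ContinuousLinearMap.integral_apply (hρ.integrable_ketbra v)]
  simp only [ketbra_apply]

/-- Left invariance of the Haar measure, applied to g ↦ hg. -/
theorem IsUnitaryRep.integral_ketbra_comm (hρ : IsUnitaryRep ρ) (v x : V) (h : SU d) :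
    (∫ g, ketbra (ρ g v) ∂SU.haar d) (ρ h x) = ρ h ((∫ g, ketbra (ρ g v) ∂SU.haar d) x) := by
  rw [hρ.integral_ketbra_apply, hρ.integral_ketbra_apply,
    IsUnitaryRep.map_integral h (hρ.continuous_matrixCoeff_smul v x),
    ← integral_mul_left_eq_self (fun g => inner ℂ (ρ g v) (ρ h x) • ρ g v) h]
  congr 1
  funext g
  rw [_root_.map_mul, Module.End.mul_apply, hρ.inner_map_map, map_smul]

/-- **Schur orthogonality**, as a resolution of the identity by the orbit of a unit vector. -/
theorem IsUnitaryRep.integral_orbit (hρ : IsUnitaryRep ρ) (hirr : ρ.IsIrreducible) {v : V}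
    (hv : ‖v‖ = 1) (x : V) :
    ∫ g, inner ℂ (ρ g v) x • ρ g v ∂SU.haar d = (Module.finrank ℂ V : ℂ)⁻¹ • x := by
  have := FiniteDimensional.complete ℂ V
  let T : V →L[ℂ] V := ∫ g, ketbra (ρ g v) ∂SU.haar d
  let f : ρ.IntertwiningMap ρ := ⟨T.toLinearMap, fun h => by
    ext x
    exact hρ.integral_ketbra_comm v x h⟩
  -- By Schur's lemma the average is a scalar; its trace is that of a unit vector's projector,
  -- namely 1, which fixes the scalar as 1 / dim V.
  obtain ⟨c, hc⟩ := hirr.algebraMap_intertwiningMap_bijective_of_isAlgClosed.2 f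
  have hT : ∀ x, T x = c • x := fun x => (congrArg (fun F : ρ.IntertwiningMap ρ => F x) hc).symm
  have htr : LinearMap.trace ℂ V T.toLinearMap = 1 := by
    rw [← traceCLM_apply, ← (traceCLM V).integral_comp_comm (hρ.integrable_ketbra v)]
    simp [traceCLM_apply, trace_ketbra, hρ.norm_map, hv]
  have hTc : T.toLinearMap = c • LinearMap.id := LinearMap.ext hT
  rw [hTc, map_smul, LinearMap.trace_id, smul_eq_mul] at htr
  rw [← hρ.integral_ketbra_apply]
  exact (hT x).trans (by rw [eq_inv_of_mul_eq_one_left htr])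

/-- Schur orthogonality for an irreducible subrepresentation. -/
theorem IsUnitaryRep.integral_orbit_subrepresentation (hρ : IsUnitaryRep ρ)
    (C : Subrepresentation ρ) (hC : C.toRepresentation.IsIrreducible) {v x : V} (hvC : v ∈ C)
    (hv : ‖v‖ = 1) (hx : x ∈ C) :
    ∫ g, inner ℂ (ρ g v) x • ρ g v ∂SU.haar d = (Module.finrank ℂ C.toSubmodule : ℂ)⁻¹ • x := by
  have := FiniteDimensional.complete ℂ V
  have hCu : IsUnitaryRep C.toRepresentation :=
    ⟨fun g x y => hρ.inner_map_map g x y,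
      fun x => (hρ.continuous_apply (x : V)).subtype_mk _⟩
  have h1 := congrArg C.toSubmodule.subtypeL
    (hCu.integral_orbit hC (v := ⟨v, hvC⟩) hv ⟨x, hx⟩)
  rw [← ContinuousLinearMap.integral_comp_comm _
    (SU.integrable_haar (hCu.continuous_matrixCoeff_smul ⟨v, hvC⟩ ⟨x, hx⟩)), map_smul] at h1
  exact h1

end Schur

/-! ### Partial contractions and the partial trace -/

section Contraction

variable {V W : Type*} [NormedAddCommGroup V] [InnerProductSpace ℂ V]
  [NormedAddCommGroup W] [InnerProductSpace ℂ W]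

/-- The contraction `⟨x| ⊗ 1`. -/
noncomputable def braLeft (x : V) : V ⊗[ℂ] W →ₗ[ℂ] W :=
  (TensorProduct.lid ℂ W).toLinearMap ∘ₗ LinearMap.rTensor W (innerₛₗ ℂ x)

/-- The contraction `1 ⊗ ⟨w|`. -/
noncomputable def braRight (w : W) : V ⊗[ℂ] W →ₗ[ℂ] V :=
  (TensorProduct.rid ℂ V).toLinearMap ∘ₗ LinearMap.lTensor V (innerₛₗ ℂ w)

theorem braLeft_tmul (x a : V) (b : W) :
    braLeft x (a ⊗ₜ[ℂ] b) = inner ℂ x a • b := by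
  simp [braLeft]

theorem braRight_tmul (w b : W) (a : V) :
    braRight w (a ⊗ₜ[ℂ] b) = inner ℂ w b • a := by
  simp [braRight]

theorem inner_braLeft (x : V) (w : W) (Θ : V ⊗[ℂ] W) :
    inner ℂ w (braLeft x Θ) = inner ℂ (x ⊗ₜ[ℂ] w) Θ := by
  induction Θ with
  | zero => simp
  | tmul a b => rw [braLeft_tmul, inner_smul_right, TensorProduct.inner_tmul]
  | add Θ Θ' h h' => rw [map_add, inner_add_right, inner_add_right, h, h']

theorem inner_braRight (x : V) (w : W) (Θ : V ⊗[ℂ] W) :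
    inner ℂ x (braRight w Θ) = inner ℂ (x ⊗ₜ[ℂ] w) Θ := by
  induction Θ with
  | zero => simp
  | tmul a b => rw [braRight_tmul, inner_smul_right, TensorProduct.inner_tmul, mul_comm]
  | add Θ Θ' h h' => rw [map_add, inner_add_right, inner_add_right, h, h']

variable [FiniteDimensional ℂ V] [FiniteDimensional ℂ W]

theorem partialTrace_add (A B : V ⊗[ℂ] W →L[ℂ] V ⊗[ℂ] W) :
    partialTrace (A + B) = partialTrace A + partialTrace B := by
  simp only [partialTrace, ContinuousLinearMap.toLinearMap_add, map_add]

theorem partialTrace_zero : partialTrace (0 : V ⊗[ℂ] W →L[ℂ] V ⊗[ℂ] W) = 0 := by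
  simp only [partialTrace, ContinuousLinearMap.toLinearMap_zero, map_zero]

theorem partialTrace_rankOne_tmul (a a' : V) (b b' : W) :
    partialTrace (InnerProductSpace.rankOne ℂ (a ⊗ₜ[ℂ] b) (a' ⊗ₜ[ℂ] b')) =
      (inner ℂ b' b : ℂ) • InnerProductSpace.rankOne ℂ a a' := by
  have h : (InnerProductSpace.rankOne ℂ (a ⊗ₜ[ℂ] b) (a' ⊗ₜ[ℂ] b')).toLinearMap =
      homTensorHomEquiv ℂ V W V W ((InnerProductSpace.rankOne ℂ a a').toLinearMap ⊗ₜ[ℂ]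
        (InnerProductSpace.rankOne ℂ b b').toLinearMap) := by
    ext x y
    simp [← TensorProduct.smul_tmul', smul_smul, mul_comm]
  rw [partialTrace, h, LinearEquiv.symm_apply_apply, LinearMap.lTensor_tmul,
    TensorProduct.rid_tmul, InnerProductSpace.trace_rankOne]
  rfl

/-- Two independent vectors make both sides additive in each of them, which reduces the claim to
pure tensors; the operator |Ψ⟩⟨Ψ| alone is quadratic in Ψ. -/
theorem inner_partialTrace_rankOne (Θ Θ' : V ⊗[ℂ] W) (x y : V) :
    inner ℂ x (partialTrace (InnerProductSpace.rankOne ℂ Θ Θ') y) =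
      inner ℂ (braLeft y Θ') (braLeft x Θ) := by
  induction Θ with
  | zero => simp [partialTrace_zero]
  | add Θ Θ₁ h h₁ =>
    rw [map_add, add_apply, partialTrace_add, add_apply, inner_add_right, h, h₁, map_add,
      inner_add_right]
  | tmul a b =>
    induction Θ' with
    | zero => simp [partialTrace_zero]
    | add Θ Θ₁ h h₁ =>
      rw [map_add, partialTrace_add, add_apply, inner_add_right, h, h₁, map_add,
        inner_add_left]
    | tmul a' b' =>
      rw [partialTrace_rankOne_tmul, smul_apply, InnerProductSpace.rankOne_apply,
        braLeft_tmul, braLeft_tmul, inner_smul_left, inner_smul_right, inner_smul_right,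
        inner_smul_right, inner_conj_symm]
      ring

theorem inner_partialTrace_ketbra (Ψ : V ⊗[ℂ] W) (x y : V) :
    inner ℂ x (partialTrace (ketbra Ψ) y) = inner ℂ (braLeft y Ψ) (braLeft x Ψ) :=
  inner_partialTrace_rankOne Ψ Ψ x y

theorem trace_partialTrace_ketbra (Ψ : V ⊗[ℂ] W) :
    LinearMap.trace ℂ V (partialTrace (ketbra Ψ)).toLinearMap = ((‖Ψ‖ ^ 2 : ℝ) : ℂ) := by
  let e := stdOrthonormalBasis ℂ V
  let f := stdOrthonormalBasis ℂ W
  rw [LinearMap.trace_eq_sum_inner _ e]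
  have h : ∀ i, inner ℂ (e i) (partialTrace (ketbra Ψ) (e i)) =
      ((∑ j, ‖inner ℂ (e i ⊗ₜ[ℂ] f j) Ψ‖ ^ 2 : ℝ) : ℂ) := by
    intro i
    rw [inner_partialTrace_ketbra, inner_self_eq_norm_sq_to_K]
    have h1 := f.sum_sq_norm_inner_right (braLeft (e i) Ψ)
    simp only [inner_braLeft] at h1
    rw [h1]
    norm_cast
  have h2 := OrthonormalBasis.sum_sq_norm_inner_right (E := V ⊗[ℂ] W) (e.tensorProduct f) Ψ
  rw [Fintype.sum_prod_type] at h2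
  rw [← h2, Complex.ofReal_sum]
  refine Finset.sum_congr rfl fun i _ => (h i).trans ?_
  simp only [OrthonormalBasis.tensorProduct_apply]

end Contraction

/-! ### The trace norm of a difference of positive operators -/

/-- In an eigenbasis e_i of X - Y with eigenvalues a_i, the root B of (X - Y)² satisfies ‖B e_i‖ =
|a_i|, hence ⟨e_i, B e_i⟩ ≤ |a_i|. Positivity bounds |a_i| = |⟨e_i, X e_i⟩ - ⟨e_i, Y e_i⟩| by the
sum of the two terms. -/
theorem traceNorm_sub_le {V : Type*} [NormedAddCommGroup V] [InnerProductSpace ℂ V]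
    [CompleteSpace V] [FiniteDimensional ℂ V] {X Y : V →L[ℂ] V} (hX : X.IsPositive)
    (hY : Y.IsPositive) :
    traceNorm (X - Y) ≤ (1 / 2) * ((LinearMap.trace ℂ V X.toLinearMap).re +
      (LinearMap.trace ℂ V Y.toLinearMap).re) := by
  have hA : IsSelfAdjoint (X - Y) := hX.isSelfAdjoint.sub hY.isSelfAdjoint
  have hsym : (X - Y).toLinearMap.IsSymmetric := hA.isSymmetric
  let e := hsym.eigenvectorBasis rfl
  let a := hsym.eigenvalues rfl
  have hea : ∀ i, (X - Y) (e i) = (a i : ℂ) • e i := hsym.apply_eigenvectorBasis rfl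
  let B : V →L[ℂ] V := CFC.sqrt (star (X - Y) * (X - Y))
  have hB : B.IsPositive :=
    (ContinuousLinearMap.nonneg_iff_isPositive _).1 (CFC.sqrt_nonneg _)
  have hBB : B * B = (X - Y) * (X - Y) := by
    rw [CFC.sqrt_mul_sqrt_self _ (star_mul_self_nonneg _), hA.star_eq]
  have hnorm : ∀ i, ‖B (e i)‖ = |a i| := by
    intro i
    have h1 : (inner ℂ (B (e i)) (B (e i)) : ℂ) = (a i : ℂ) ^ 2 := by
      refine (hB.isSelfAdjoint.isSymmetric (e i) (B (e i))).trans ?_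
      change inner ℂ (e i) ((B * B) (e i)) = _
      rw [hBB, mul_apply_eq_comp, hea, map_smul, hea, smul_smul, inner_smul_right,
        inner_self_eq_norm_sq_to_K, e.orthonormal.norm_eq_one]
      simp [pow_two]
    rw [inner_self_eq_norm_sq_to_K] at h1
    have h2 : ‖B (e i)‖ ^ 2 = a i ^ 2 := Complex.ofReal_injective (by push_cast; exact h1)
    rw [← Real.sqrt_sq_eq_abs, ← h2, Real.sqrt_sq (norm_nonneg _)]
  have hterm : ∀ i, (inner ℂ (e i) (B (e i)) : ℂ).re ≤
      (inner ℂ (e i) (X (e i)) : ℂ).re + (inner ℂ (e i) (Y (e i)) : ℂ).re := by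
    intro i
    have h1 : (inner ℂ (e i) (B (e i)) : ℂ).re ≤ |a i| := by
      refine (Complex.re_le_norm _).trans ((norm_inner_le_norm _ _).trans ?_)
      rw [e.orthonormal.norm_eq_one, one_mul, hnorm]
    have h2 : a i = (inner ℂ (e i) (X (e i)) : ℂ).re - (inner ℂ (e i) (Y (e i)) : ℂ).re := by
      rw [← Complex.sub_re, ← inner_sub_right, ← sub_apply, hea, inner_smul_right,
        inner_self_eq_norm_sq_to_K, e.orthonormal.norm_eq_one]
      simp
    have hx : 0 ≤ (inner ℂ (e i) (X (e i)) : ℂ).re := hX.re_inner_nonneg_right (e i)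
    have hy : 0 ≤ (inner ℂ (e i) (Y (e i)) : ℂ).re := hY.re_inner_nonneg_right (e i)
    refine h1.trans (abs_le.2 ⟨?_, ?_⟩) <;> linarith
  unfold traceNorm
  refine mul_le_mul_of_nonneg_left ?_ (by norm_num)
  rw [LinearMap.trace_eq_sum_inner _ e, LinearMap.trace_eq_sum_inner X.toLinearMap e,
    LinearMap.trace_eq_sum_inner Y.toLinearMap e, Complex.re_sum, Complex.re_sum, Complex.re_sum,
    ← Finset.sum_add_distrib]
  exact Finset.sum_le_sum fun i _ => hterm i

/-! ### Approximation of the partial trace by a mixture of coherent states -/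

theorem inner_integral_ketbra_apply {d : ℕ} {V : Type*} [NormedAddCommGroup V]
    [InnerProductSpace ℂ V] [FiniteDimensional ℂ V] {f : SU d → V} (hf : Continuous f) (x y : V) :
    inner ℂ x ((∫ g, ketbra (f g) ∂SU.haar d) y) =
      ∫ g, inner ℂ x (f g) * inner ℂ (f g) y ∂SU.haar d := by
  have := FiniteDimensional.complete ℂ V
  have hi : Integrable (fun g => ketbra (f g)) (SU.haar d) :=
    SU.integrable_haar (continuous_ketbra.comp hf)
  rw [ContinuousLinearMap.integral_apply hi, ← integral_inner (hi.apply_continuousLinearMap y)]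
  congr 1
  funext g
  rw [ketbra_apply, inner_smul_right, mul_comm]

theorem isPositive_integral_ketbra {d : ℕ} {V : Type*} [NormedAddCommGroup V]
    [InnerProductSpace ℂ V] [FiniteDimensional ℂ V] {f : SU d → V} (hf : Continuous f) :
    (∫ g, ketbra (f g) ∂SU.haar d).IsPositive := by
  have := FiniteDimensional.complete ℂ V
  rw [ContinuousLinearMap.isPositive_iff_complex]
  intro x
  have h : inner ℂ ((∫ g, ketbra (f g) ∂SU.haar d) x) x =
      ((∫ g, ‖inner ℂ x (f g)‖ ^ 2 ∂SU.haar d : ℝ) : ℂ) := by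
    rw [← inner_conj_symm, inner_integral_ketbra_apply hf, ← integral_complex_ofReal,
      ← integral_conj]
    congr 1
    funext g
    rw [← inner_conj_symm (f g) x, RCLike.mul_conj]
    simp
  rw [h]
  refine ⟨by simp, ?_⟩
  simpa using integral_nonneg fun g => by positivity

section Coherent

variable {d : ℕ} {V W : Type*} [NormedAddCommGroup V] [InnerProductSpace ℂ V]
  [NormedAddCommGroup W] [InnerProductSpace ℂ W]
  {ρ : Representation ℂ (SU d) V} {σ : Representation ℂ (SU d) W}

theorem IsUnitaryRep.tprod (hρ : IsUnitaryRep ρ) (hσ : IsUnitaryRep σ) :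
    IsUnitaryRep (ρ.tprod σ) where
  inner_map_map := hρ.tprod_inner hσ
  continuous_apply Θ := by
    induction Θ with
    | zero => simpa using continuous_const
    | tmul a b =>
      exact TensorProduct.continuous_tmul.comp
        ((hρ.continuous_apply a).prodMk (hσ.continuous_apply b))
    | add Θ Θ' h h' =>
      simp only [map_add]
      exact h.add h'

theorem continuous_braRight (Ψ : V ⊗[ℂ] W) : Continuous fun w : W => braRight w Ψ := by
  induction Ψ with
  | zero => simpa using continuous_const
  | tmul a b =>
    simp only [braRight_tmul]
    exact (continuous_id.inner continuous_const).smul continuous_const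
  | add Θ Θ' h h' =>
    simp only [map_add]
    exact h.add h'

/-- The amplitude of `Ψ` along the translate by `g` of the product vector `v ⊗ w`. -/
noncomputable def amplitude (ρ : Representation ℂ (SU d) V) (σ : Representation ℂ (SU d) W) (v : V)
    (w : W) (Ψ : V ⊗[ℂ] W) (g : SU d) : ℂ :=
  inner ℂ (ρ g v ⊗ₜ[ℂ] σ g w) Ψ

/-- The component orthogonal to `g v` of the vector `(1 ⊗ ⟨g w|) Ψ`. -/
noncomputable def residualVector (ρ : Representation ℂ (SU d) V)
    (σ : Representation ℂ (SU d) W) (v : V) (w : W) (Ψ : V ⊗[ℂ] W) (g : SU d) : V :=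
  braRight (σ g w) Ψ - amplitude ρ σ v w Ψ g • ρ g v

theorem continuous_amplitude (hρ : IsUnitaryRep ρ) (hσ : IsUnitaryRep σ) (v : V) (w : W)
    (Ψ : V ⊗[ℂ] W) : Continuous (amplitude ρ σ v w Ψ) :=
  ((hρ.tprod hσ).continuous_apply (v ⊗ₜ[ℂ] w)).inner continuous_const

theorem continuous_residualVector (hρ : IsUnitaryRep ρ) (hσ : IsUnitaryRep σ) (v : V) (w : W)
    (Ψ : V ⊗[ℂ] W) : Continuous (residualVector ρ σ v w Ψ) :=
  ((continuous_braRight Ψ).comp (hσ.continuous_apply w)).sub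
    ((continuous_amplitude hρ hσ v w Ψ).smul (hρ.continuous_apply v))

variable [FiniteDimensional ℂ V] [FiniteDimensional ℂ W]

theorem integral_inner_braLeft (hσ : IsUnitaryRep σ) (hσirr : σ.IsIrreducible) {w : W}
    (hw : ‖w‖ = 1) (a b : W) :
    ∫ g, inner ℂ (σ g w) a * inner ℂ b (σ g w) ∂SU.haar d =
      (Module.finrank ℂ W : ℂ)⁻¹ * inner ℂ b a := by
  have := FiniteDimensional.complete ℂ W
  rw [← inner_smul_right, ← hσ.integral_orbit hσirr hw a,
    ← integral_inner (SU.integrable_haar (hσ.continuous_matrixCoeff_smul w a))]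
  congr 1
  funext g
  rw [inner_smul_right]

/-- A linear functional applied to Schur orthogonality in `C`. One choice of `L` yields the
normalization of the measure, another the cross terms of the residual. -/
theorem integral_amplitude_mul (hρ : IsUnitaryRep ρ) (hσ : IsUnitaryRep σ)
    {C : Subrepresentation (ρ.tprod σ)} (hC : C.toRepresentation.IsIrreducible) {v : V} {w : W}
    (hvw : v ⊗ₜ[ℂ] w ∈ C) (hv : ‖v‖ = 1) (hw : ‖w‖ = 1) {Ψ : V ⊗[ℂ] W} (hΨ : Ψ ∈ C)
    (L : V ⊗[ℂ] W →ₗ[ℂ] ℂ) :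
    ∫ g, amplitude ρ σ v w Ψ g * L (ρ g v ⊗ₜ[ℂ] σ g w) ∂SU.haar d =
      (Module.finrank ℂ C.toSubmodule : ℂ)⁻¹ * L Ψ := by
  have hτ := hρ.tprod hσ
  have h := hτ.integral_orbit_subrepresentation C hC hvw (by simp [hv, hw]) hΨ
  have h1 := congrArg (LinearMap.toContinuousLinearMap L) h
  rw [← ContinuousLinearMap.integral_comp_comm _
    (SU.integrable_haar (hτ.continuous_matrixCoeff_smul _ _)), map_smul, smul_eq_mul] at h1
  refine Eq.trans ?_ h1
  congr 1
  funext g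
  rw [map_smul, smul_eq_mul]
  rfl

theorem integral_norm_amplitude_sq (hρ : IsUnitaryRep ρ) (hσ : IsUnitaryRep σ)
    {C : Subrepresentation (ρ.tprod σ)} (hC : C.toRepresentation.IsIrreducible) {v : V} {w : W}
    (hvw : v ⊗ₜ[ℂ] w ∈ C) (hv : ‖v‖ = 1) (hw : ‖w‖ = 1) {Ψ : V ⊗[ℂ] W} (hΨ : Ψ ∈ C) :
    ∫ g, ‖amplitude ρ σ v w Ψ g‖ ^ 2 ∂SU.haar d =
      (Module.finrank ℂ C.toSubmodule : ℝ)⁻¹ * ‖Ψ‖ ^ 2 := by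
  have h := integral_amplitude_mul hρ hσ hC hvw hv hw hΨ (innerₛₗ ℂ Ψ)
  have h1 : ∀ g, amplitude ρ σ v w Ψ g * (innerₛₗ ℂ Ψ) (ρ g v ⊗ₜ[ℂ] σ g w) =
      ((‖amplitude ρ σ v w Ψ g‖ ^ 2 : ℝ) : ℂ) := by
    intro g
    rw [innerₛₗ_apply_apply, ← inner_conj_symm, ← amplitude, RCLike.mul_conj]
    simp
  rw [integral_congr_ae (.of_forall h1), integral_complex_ofReal, innerₛₗ_apply_apply,
    inner_self_eq_norm_sq_to_K] at h
  exact Complex.ofReal_injective (by push_cast; exact h)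

/-- The decomposition of the residual in terms of the partial trace and the mixture of the
coherent states `g v`. -/
theorem inner_integral_ketbra_residualVector (hρ : IsUnitaryRep ρ) (hσ : IsUnitaryRep σ)
    (hσirr : σ.IsIrreducible) {C : Subrepresentation (ρ.tprod σ)}
    (hC : C.toRepresentation.IsIrreducible) {v : V} {w : W} (hvw : v ⊗ₜ[ℂ] w ∈ C) (hv : ‖v‖ = 1)
    (hw : ‖w‖ = 1) {Ψ : V ⊗[ℂ] W} (hΨ : Ψ ∈ C) (x y : V) :
    inner ℂ x ((∫ g, ketbra (residualVector ρ σ v w Ψ g) ∂SU.haar d) y) =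
      ((Module.finrank ℂ W : ℂ)⁻¹ - 2 * (Module.finrank ℂ C.toSubmodule : ℂ)⁻¹) *
          inner ℂ x (partialTrace (ketbra Ψ) y) +
        inner ℂ x ((∫ g, ketbra (amplitude ρ σ v w Ψ g • ρ g v) ∂SU.haar d) y) := by
  have hn := hσ.continuous_apply w
  have hc := continuous_amplitude hρ hσ v w Ψ
  have hb := (continuous_braRight Ψ).comp hn
  have hcu : Continuous fun g => amplitude ρ σ v w Ψ g • ρ g v := hc.smul (hρ.continuous_apply v)
  have hbra : ∀ z g, inner ℂ z (braRight (σ g w) Ψ) = inner ℂ (σ g w) (braLeft z Ψ) := by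
    intro z g
    rw [inner_braRight, inner_braLeft]
  have hbra' : ∀ z g, inner ℂ (braRight (σ g w) Ψ) z = inner ℂ (braLeft z Ψ) (σ g w) := by
    intro z g
    rw [← inner_conj_symm, hbra, inner_conj_symm]
  have h1 := integral_inner_braLeft hσ hσirr hw (braLeft x Ψ) (braLeft y Ψ)
  -- A cross term: the integrand is c(g) times a linear functional of gv ⊗ gw, so orthogonality in
  -- `C` evaluates it at Ψ.
  have h2 : ∀ x y : V, ∫ g, inner ℂ x (amplitude ρ σ v w Ψ g • ρ g v) *
      inner ℂ (braRight (σ g w) Ψ) y ∂SU.haar d =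
        (Module.finrank ℂ C.toSubmodule : ℂ)⁻¹ * inner ℂ (braLeft y Ψ) (braLeft x Ψ) := by
    intro x y
    refine Eq.trans ?_ (integral_amplitude_mul hρ hσ hC hvw hv hw hΨ
      (innerₛₗ ℂ (braLeft y Ψ) ∘ₗ braLeft x))
    congr 1
    funext g
    rw [LinearMap.comp_apply, innerₛₗ_apply_apply, braLeft_tmul, inner_smul_right,
      inner_smul_right, hbra', mul_assoc]
  -- The other cross term is the complex conjugate of the first with x and y exchanged.
  have h3 : ∫ g, inner ℂ x (braRight (σ g w) Ψ) *
      inner ℂ (amplitude ρ σ v w Ψ g • ρ g v) y ∂SU.haar d =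
        (Module.finrank ℂ C.toSubmodule : ℂ)⁻¹ * inner ℂ (braLeft y Ψ) (braLeft x Ψ) := by
    have h := congrArg (starRingEnd ℂ) (h2 y x)
    rw [← integral_conj] at h
    simp only [_root_.map_mul, inner_conj_symm, map_inv₀, map_natCast] at h
    rw [← h]
    congr 1
    funext g
    rw [mul_comm]
  have i1 : Integrable (fun g => inner ℂ (σ g w) (braLeft x Ψ) * inner ℂ (braLeft y Ψ) (σ g w))
      (SU.haar d) :=
    SU.integrable_haar ((hn.inner continuous_const).mul (continuous_const.inner hn))
  have i2 : Integrable (fun g => inner ℂ x (amplitude ρ σ v w Ψ g • ρ g v) *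
      inner ℂ (braRight (σ g w) Ψ) y) (SU.haar d) :=
    SU.integrable_haar ((continuous_const.inner hcu).mul (hb.inner continuous_const))
  have i3 : Integrable (fun g => inner ℂ x (braRight (σ g w) Ψ) *
      inner ℂ (amplitude ρ σ v w Ψ g • ρ g v) y) (SU.haar d) :=
    SU.integrable_haar ((continuous_const.inner hb).mul (hcu.inner continuous_const))
  have i4 : Integrable (fun g => inner ℂ x (amplitude ρ σ v w Ψ g • ρ g v) *
      inner ℂ (amplitude ρ σ v w Ψ g • ρ g v) y) (SU.haar d) :=
    SU.integrable_haar ((continuous_const.inner hcu).mul (hcu.inner continuous_const))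
  rw [inner_integral_ketbra_apply (continuous_residualVector hρ hσ v w Ψ),
    inner_integral_ketbra_apply hcu, inner_partialTrace_ketbra]
  have hexp : ∀ g, inner ℂ x (residualVector ρ σ v w Ψ g) * inner ℂ (residualVector ρ σ v w Ψ g) y =
      inner ℂ (σ g w) (braLeft x Ψ) * inner ℂ (braLeft y Ψ) (σ g w) -
        inner ℂ x (amplitude ρ σ v w Ψ g • ρ g v) * inner ℂ (braRight (σ g w) Ψ) y -
        inner ℂ x (braRight (σ g w) Ψ) * inner ℂ (amplitude ρ σ v w Ψ g • ρ g v) y +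
        inner ℂ x (amplitude ρ σ v w Ψ g • ρ g v) *
          inner ℂ (amplitude ρ σ v w Ψ g • ρ g v) y := by
    intro g
    rw [residualVector, inner_sub_left, inner_sub_right, ← hbra, ← hbra']
    ring
  rw [integral_congr_ae (.of_forall hexp)]
  refine ((integral_add ((i1.sub i2).sub i3) i4).trans (congrArg (· + _)
    ((integral_sub (i1.sub i2) i3).trans (congrArg (· - _) (integral_sub i1 i2))))).trans ?_
  rw [h1, h2, h3]
  ring

end Coherent

/-! ### Assembly of the estimate -/

theorem ketbra_smul {E : Type*} [NormedAddCommGroup E] [InnerProductSpace ℂ E] (c : ℂ) (ψ : E) :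
    ketbra (c • ψ) = (‖c‖ ^ 2 : ℝ) • ketbra ψ := by
  ext x
  rw [smul_apply, ketbra_apply, ketbra_apply, inner_smul_left, smul_smul,
    RCLike.real_smul_eq_coe_smul (K := ℂ), smul_smul]
  congr 1
  have : (starRingEnd ℂ) c * c = ((‖c‖ ^ 2 : ℝ) : ℂ) := by
    rw [RCLike.conj_mul]; simp
  calc _ = ((starRingEnd ℂ) c * c) * inner ℂ ψ x := by ring
    _ = _ := by rw [this]; rfl

/-- Integrability is part of the conclusion because the Bochner integral of a non-integrable
function is 0 by convention. -/
theorem corollary4 (d : ℕ) (μ ν : Fin d → ℤ)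
    {V W : Type*}
    [NormedAddCommGroup V] [InnerProductSpace ℂ V] [CompleteSpace V] [FiniteDimensional ℂ V]
    [NormedAddCommGroup W] [InnerProductSpace ℂ W] [CompleteSpace W] [FiniteDimensional ℂ W]
    (ρ : Representation ℂ (SU d) V) (hρ : IsUnitaryRep ρ)
    (hρirr : ρ.IsIrreducible) (hρμ : IsHighestWeight ρ μ)
    (σ : Representation ℂ (SU d) W) (hσ : IsUnitaryRep σ)
    (hσirr : σ.IsIrreducible) (hσν : IsHighestWeight σ ν)
    (C : Subrepresentation (ρ.tprod σ))
    (hCirr : C.toRepresentation.IsIrreducible)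
    (hCw : IsHighestWeight C.toRepresentation (μ + ν))
    (vμ : V) (hvμ : IsWeightVector ρ μ vμ) (hvμ_norm : ‖vμ‖ = 1)
    (Ψ : V ⊗[ℂ] W) (hΨ : Ψ ∈ C) (hΨ_norm : ‖Ψ‖ = 1) :
    ∃ m : MeasureTheory.Measure (SU d), MeasureTheory.IsProbabilityMeasure m ∧
      MeasureTheory.Integrable (fun g : SU d => ketbra (ρ g vμ)) m ∧
      traceNorm (partialTrace (ketbra Ψ) - ∫ g : SU d, ketbra (ρ g vμ) ∂m) ≤
        2 * (1 - (Module.finrank ℂ W : ℝ) / (Module.finrank ℂ C.toSubmodule : ℝ)) := by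
  obtain ⟨w₀, hw₀0, hw₀⟩ := hσν.1
  let w : W := ((‖w₀‖⁻¹ : ℝ) : ℂ) • w₀
  have hw : IsWeightVector σ ν w := fun h hh => by rw [map_smul, hw₀ h hh, smul_comm]
  have hw1 : ‖w‖ = 1 := by
    rw [norm_smul, Complex.norm_real, norm_inv, norm_norm,
      inv_mul_cancel₀ (norm_ne_zero_iff.2 hw₀0)]
  have hvw : vμ ⊗ₜ[ℂ] w ∈ C :=
    tmul_mem_of_isWeight hρ hρirr hσ hσirr hρμ hσν hvμ hvμ_norm hw hw1 hCw.1
  have := hσirr.nontrivial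
  have := hCirr.nontrivial
  have hW0 : (0 : ℝ) < Module.finrank ℂ W := by exact_mod_cast Module.finrank_pos
  have hC0 : (0 : ℝ) < Module.finrank ℂ C.toSubmodule := by exact_mod_cast Module.finrank_pos
  set dW : ℝ := (Module.finrank ℂ W : ℝ) with hdW
  set dC : ℝ := (Module.finrank ℂ C.toSubmodule : ℝ) with hdC
  let c : SU d → ℂ := amplitude ρ σ vμ w Ψ
  have hc : Continuous c := continuous_amplitude hρ hσ vμ w Ψ
  have hpc : Continuous fun g => dC * ‖c g‖ ^ 2 := continuous_const.mul (hc.norm.pow 2)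
  have hint := integral_norm_amplitude_sq hρ hσ hCirr hvw hvμ_norm hw1 hΨ
  rw [hΨ_norm, one_pow, mul_one] at hint
  -- Since Ψ is a unit vector, |c|² has Haar integral 1 / dim C; the factor `dC` makes the total
  -- mass 1.
  let m : Measure (SU d) := (SU.haar d).withDensity fun g => ENNReal.ofReal (dC * ‖c g‖ ^ 2)
  have hm : IsProbabilityMeasure m := by
    refine ⟨?_⟩
    rw [withDensity_apply _ MeasurableSet.univ, Measure.restrict_univ,
      ← ofReal_integral_eq_lintegral_ofReal (SU.integrable_haar hpc)
      (.of_forall fun g => by positivity), integral_const_mul, hint, mul_inv_cancel₀ hC0.ne',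
      ENNReal.ofReal_one]
  have hmi : Integrable (fun g : SU d => ketbra (ρ g vμ)) m :=
    (continuous_ketbra.comp (hρ.continuous_apply vμ)).integrable_of_hasCompactSupport
      (HasCompactSupport.of_compactSpace _)
  refine ⟨m, hm, hmi, ?_⟩
  let ξ : V →L[ℂ] V := partialTrace (ketbra Ψ)
  let B : V →L[ℂ] V := ∫ g : SU d, ketbra (ρ g vμ) ∂m
  let B₀ : V →L[ℂ] V := ∫ g, ketbra (c g • ρ g vμ) ∂SU.haar d
  let S₀ : V →L[ℂ] V := ∫ g, ketbra (residualVector ρ σ vμ w Ψ g) ∂SU.haar d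
  have hB : B = (dC : ℂ) • B₀ := by
    simp only [B, m, B₀]
    rw [integral_withDensity_eq_integral_toReal_smul hpc.measurable.ennreal_ofReal
      (.of_forall fun g => ENNReal.ofReal_lt_top), ← integral_smul]
    congr 1
    funext g
    rw [ENNReal.toReal_ofReal (by positivity), ketbra_smul, mul_smul]
    exact RCLike.real_smul_eq_coe_smul (K := ℂ) _ _
  have hBpos : B.IsPositive := by
    rw [hB]
    exact (isPositive_integral_ketbra (hc.smul (hρ.continuous_apply vμ))).smul_of_nonneg
      (by exact_mod_cast hC0.le)
  have hS₀pos : S₀.IsPositive := isPositive_integral_ketbra (continuous_residualVector hρ hσ vμ w Ψ)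
  have hξpos : ξ.IsPositive := by
    rw [ContinuousLinearMap.isPositive_iff_complex]
    intro x
    rw [← inner_conj_symm, inner_partialTrace_ketbra, inner_conj_symm, inner_self_eq_norm_sq_to_K]
    norm_cast
    exact ⟨rfl, by positivity⟩
  have hS₀ : S₀ = ((dW : ℂ)⁻¹ - 2 * (dC : ℂ)⁻¹) • ξ + (dC : ℂ)⁻¹ • B := by
    ext y
    refine ext_inner_left ℂ fun x => ?_
    rw [add_apply, smul_apply, smul_apply, inner_add_right, inner_smul_right, inner_smul_right, hB,
      smul_apply, inner_smul_right, inv_mul_cancel_left₀ (by exact_mod_cast hC0.ne')]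
    refine (inner_integral_ketbra_residualVector hρ hσ hσirr hCirr hvw hvμ_norm hw1 hΨ x y).trans ?_
    simp only [hdW, hdC, Complex.ofReal_natCast]
    rfl
  have htξ : traceCLM V ξ = 1 := by
    rw [traceCLM_apply, trace_partialTrace_ketbra, hΨ_norm]
    simp
  have htB : traceCLM V B = 1 := by
    rw [← (traceCLM V).integral_comp_comm hmi]
    simp [traceCLM_apply, trace_ketbra, hρ.norm_map, hvμ_norm]
  have htS₀ : traceCLM V S₀ = ((dW⁻¹ - dC⁻¹ : ℝ) : ℂ) := by
    rw [hS₀, map_add, map_smul, map_smul, htξ, htB]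
    push_cast
    simp only [smul_eq_mul]
    ring
  let r : ℝ := dW / dC
  have hr : 0 ≤ 1 - r := by
    -- The trace 1 / dim W - 1 / dim C of the positive operator S₀ is nonnegative, which yields dim
    -- W ≤ dim C.
    have h0 : 0 ≤ (traceCLM V S₀).re := by
      rw [traceCLM_apply, LinearMap.trace_eq_sum_inner _ (stdOrthonormalBasis ℂ V),
        Complex.re_sum]
      exact Finset.sum_nonneg fun i _ => hS₀pos.re_inner_nonneg_right _
    rw [htS₀, Complex.ofReal_re] at h0
    have h1 : 1 - r = dW * (dW⁻¹ - dC⁻¹) := by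
      simp only [r]
      field_simp
    rw [h1]
    exact mul_nonneg hW0.le h0
  -- The relation for S₀ reads dim W · S₀ = (1 - 2r) ξ + r B. Adding (1 - r) B to both sides gives Y
  -- = (1 - 2r) ξ + B, so X - Y = ξ - B with X and Y positive of equal trace.
  let X : V →L[ℂ] V := ((2 * (1 - r) : ℝ) : ℂ) • ξ
  let Y : V →L[ℂ] V := (dW : ℂ) • S₀ + ((1 - r : ℝ) : ℂ) • B
  have hXY : ξ - B = X - Y := by
    have hW0' : (dW : ℂ) ≠ 0 := by exact_mod_cast hW0.ne'
    have hC0' : (dC : ℂ) ≠ 0 := by exact_mod_cast hC0.ne'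
    simp only [X, Y, hS₀, r]
    push_cast
    match_scalars
    · field_simp
      ring
    · field_simp
      ring
  have hXpos : X.IsPositive :=
    hξpos.smul_of_nonneg (by exact_mod_cast mul_nonneg zero_le_two hr)
  have hYpos : Y.IsPositive :=
    (hS₀pos.smul_of_nonneg (by exact_mod_cast hW0.le)).add
      (hBpos.smul_of_nonneg (by exact_mod_cast hr))
  change traceNorm (ξ - B) ≤ 2 * (1 - r)
  rw [hXY]
  refine (traceNorm_sub_le hXpos hYpos).trans (le_of_eq ?_)
  have hX : traceCLM V X = ((2 * (1 - r) : ℝ) : ℂ) := by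
    simp only [X]
    rw [map_smul, htξ, smul_eq_mul, mul_one]
  have hY : traceCLM V Y = ((2 * (1 - r) : ℝ) : ℂ) := by
    simp only [Y]
    rw [map_add, map_smul, map_smul, htS₀, htB, smul_eq_mul, smul_eq_mul, mul_one,
      ← Complex.ofReal_mul, ← Complex.ofReal_add]
    congr 1
    simp only [r]
    field_simp
    ring
  rw [← traceCLM_apply, ← traceCLM_apply, hX, hY, Complex.ofReal_re]
  ring
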